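/- **Conventions.** Let $\Delta$ be a finite abstract simplicial complex on a set $V$ (with the empty face allowed) and $G$ a graph on $V$. A *tube* is a face of $\Delta$ that induces a (nonempty) connected subgraph of $G$. Two tubes are *weakly compatible* if one contains the other, or if they are disjoint and no edge of $G$ joins them. A *tubing* is a set of pairwise weakly compatible tubes whose union is a face of $\Delta$. The tubings form a simplicial complex on the set of tubes, the *tubing complex*. An *$n$-dimensional graph associahedron* of $(G,\Delta)$ is a full-dimensional simple polyhedron $P\subset\mathbb R^n$ whose dual simplicial complex (the sets of facets of $P$ with nonempty common intersection) is isomorphic to the tubing complex. For a family $P_0,P_1,P_2,\dots$ of polyhedra with $\dim P_n=n$, the *bivariate $f$-polynomial* is the power series $f^P(x,y)=\sum_{n,k\ge 0} f_k(P_n)\,x^k y^n$, where $f_k(P_n)$ is the number of nonempty $k$-dimensional faces of $P_n$ ($P_n$ itself included). Consider families of graph associahedra, indexed by $n\ge 0$, of the following graphs, with bivariate $f$-polynomials $f^A,f^B,f^C,f^{DC}$. * $A_n$ (associahedra): the path on $[n+1]$, where $\Delta$ consists of all proper subsets of $[n+1]$. * $B_n$ (cyclohedra): the cycle on $[n+1]$,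 where $\Delta$ consists of all proper subsets of $[n+1]$. * $DC_n$ (double cycle hypercube-graph associahedra): the graph on $\pm[n]=\{\pm1,\dots,\pm n\}$ consisting of the two cycles $(1,\dots,n)$ and $(-1,\dots,-n)$, where $\Delta$ consists of all subsets containing no pair $\{i,-i\}$. * $C_n$ (cis double path): the graph on $\pm[n]\setminus\{-1,-n\}$ consisting of the two paths $(1,\dots,n)$ and $(-2,\dots,-(n-1))$, where $\Delta$ consists of all subsets containing no pair $\{i,-i\}$. (All graphs are simple: a cycle on one vertex is a point, a cycle on two vertices is a single edge.) **Proposition.** With $D_y=\partial/\partial y$, $$f^{DC}(x,y)=1+(xy+2y)\,f^B+2y\,\bigl[(1+yD_y)f^A\bigr]\,(f^C-1).$$ At $x=0$ this gives the generating function of the numbers of vertices of the polytopes $DC_n$: $$f^{DC}(0,y)=1+\frac{1-\sqrt{1-4y}-2y}{1-4y}+\frac{2y}{\sqrt{1-4y}},$$ where $\sqrt{1-4y}$ is the formal power series with constant term $1$ whose square is $1-4y$. -/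

import Mathlib

open scoped PowerSeries

/-! ### Graphs on simplicial complexes, tubes and tubings

An abstract simplicial complex on a vertex set `V` is a lower set of finite subsets of `V`
(the empty face is allowed). -/

/-- A graph on the base set `V` of a simplicial complex.  An edge that is not a face of the complex
has no effect on tubes and tubings, so it is not excluded. -/
structure DeltaGraph (V : Type) where
  /-- the simplicial complex -/
  complex : LowerSet (Finset V)
  /-- the graph -/
  graph : SimpleGraph V

namespace DeltaGraph

variable {V : Type}

/-- A tube is a face of the complex that induces a connected (in particular nonempty) subgraph. -/
def IsTube (G : DeltaGraph V) (t : Finset V) : Prop :=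
  t ∈ G.complex ∧ (G.graph.induce (t : Set V)).Connected

/-- The type of tubes. -/
abbrev Tube (G : DeltaGraph V) : Type := {t : Finset V // G.IsTube t}

/-- Two tubes are weakly compatible if they are nested, or disjoint and not joined by an edge. -/
def WeaklyCompatible (G : DeltaGraph V) (s t : Finset V) : Prop :=
  s ⊆ t ∨ t ⊆ s ∨ (Disjoint s t ∧ ∀ u ∈ s, ∀ v ∈ t, ¬ G.graph.Adj u v)

/-- A tubing is a finite set of pairwise weakly compatible tubes whose union is a face of the
complex. -/
def IsTubing [DecidableEq V] (G : DeltaGraph V) (T : Finset G.Tube) : Prop :=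
  (∀ s ∈ T, ∀ t ∈ T, G.WeaklyCompatible s.1 t.1) ∧ T.biUnion (fun t => t.1) ∈ G.complex

/-- The tubing complex (nested complex): the simplicial complex of all tubings, on the set of
tubes. -/
def tubingComplex [DecidableEq V] (G : DeltaGraph V) : LowerSet (Finset G.Tube) where
  carrier := {T | G.IsTubing T}
  lower' := fun _ _ hle hT =>
    ⟨fun s hs t ht => hT.1 s (hle hs) t (hle ht),
      G.complex.lower (Finset.biUnion_subset_biUnion_of_subset_left _ hle) hT.2⟩

/-- A graph on `V`, considered on the boundary complex of a simplex: the faces are the proper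
subsets of `V`. -/
def ofSimplex [Fintype V] (H : SimpleGraph V) : DeltaGraph V where
  complex := { carrier := {s | s ≠ Finset.univ}
               lower' := fun _ _ hle hs h => hs (Finset.univ_subset_iff.mp (h.symm.subset.trans hle)) }
  graph := H

/-- The double graph `2H` as a hypercube graph.  The vertex `(i, true)` stands for `i` and
`(i, false)` for `-i`; the faces of the complex are the sets containing no pair `{i, -i}`, and
there is a copy of `H` on the positive and a copy of `H` on the negative vertices. -/
def double (H : SimpleGraph V) : DeltaGraph (V × Bool) where
  complex := { carrier := {s | ∀ i, ¬ ((i, true) ∈ s ∧ (i, false) ∈ s)}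
               lower' := fun _ _ hle hs i h => hs i ⟨hle h.1, hle h.2⟩ }
  graph := { Adj := fun u v => u.2 = v.2 ∧ H.Adj u.1 v.1
             symm := ⟨fun _ _ h => ⟨h.1.symm, h.2.symm⟩⟩
             loopless := ⟨fun _ h => H.irrefl h.2⟩ }

/-- Deleting vertices: the restriction of the graph and of the complex to the vertices
satisfying `p`. -/
def restrict (G : DeltaGraph V) (p : V → Prop) : DeltaGraph {v // p v} where
  complex := { carrier := {s | s.map (Function.Embedding.subtype p) ∈ G.complex}
               lower' := fun _ _ hle hs => G.complex.lower (Finset.map_subset_map.mpr hle) hs }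
  graph := G.graph.comap Subtype.val

/-- The path on `n + 1` vertices, on the boundary of the `n`-simplex; its polytope is the
`n`-dimensional associahedron. -/
def path (n : ℕ) : DeltaGraph (Fin (n + 1)) := ofSimplex (SimpleGraph.pathGraph (n + 1))

/-- The cycle on `n + 1` vertices, on the boundary of the `n`-simplex; its polytope is the
`n`-dimensional cyclohedron. -/
def cycle (n : ℕ) : DeltaGraph (Fin (n + 1)) := ofSimplex (SimpleGraph.cycleGraph (n + 1))

/-- The double path graph on `±[n]`. -/
def doublePath (n : ℕ) : DeltaGraph (Fin n × Bool) := double (SimpleGraph.pathGraph n)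

/-- The cis double path graph: the double path graph on `±[n]` without `-1` and `-n`
(with `Fin n` starting at `0`). -/
def cisDoublePath (n : ℕ) :
    DeltaGraph {v : Fin n × Bool // ¬ (v.2 = false ∧ (v.1.val = 0 ∨ v.1.val + 1 = n))} :=
  (doublePath n).restrict _

/-- The double cycle graph on `±[n]`. -/
def doubleCycle (n : ℕ) : DeltaGraph (Fin n × Bool) := double (SimpleGraph.cycleGraph n)

end DeltaGraph

/-! ### Polyhedra -/

namespace Polyhedral

variable {n : ℕ}

/-- A polyhedron in `ℝⁿ`: the solution set of finitely many non-strict linear inequalities. -/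
def IsPolyhedron (P : Set (EuclideanSpace ℝ (Fin n))) : Prop :=
  ∃ H : Finset (StrongDual ℝ (EuclideanSpace ℝ (Fin n)) × ℝ), P = {x | ∀ h ∈ H, h.1 x ≤ h.2}

/-- A face of `P`: the subset of `P` on which some inequality valid on `P` is an equality. The empty
face and `P` itself are included. -/
def IsFace (P F : Set (EuclideanSpace ℝ (Fin n))) : Prop :=
  ∃ (c : StrongDual ℝ (EuclideanSpace ℝ (Fin n))) (b : ℝ),
    (∀ x ∈ P, c x ≤ b) ∧ F = {x | x ∈ P ∧ c x = b}

/-- The dimension of (the affine hull of) a nonempty set. -/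
noncomputable def dim (F : Set (EuclideanSpace ℝ (Fin n))) : ℕ :=
  Module.finrank ℝ (vectorSpan ℝ F)

/-- A facet of a full-dimensional polyhedron: a nonempty face of dimension `n - 1`. -/
def IsFacet (P F : Set (EuclideanSpace ℝ (Fin n))) : Prop :=
  IsFace P F ∧ F.Nonempty ∧ dim F + 1 = n

/-- A full-dimensional polyhedron is simple if every nonempty face of codimension `d` lies in
exactly `d` facets. -/
def IsSimple (P : Set (EuclideanSpace ℝ (Fin n))) : Prop :=
  ∀ F, IsFace P F → F.Nonempty → dim F + {G | IsFacet P G ∧ F ⊆ G}.ncard = n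

/-- The dual simplicial complex: the sets of facets with nonempty common intersection
(the empty set of facets has intersection `P`). -/
def dualComplex (P : Set (EuclideanSpace ℝ (Fin n))) : LowerSet (Finset {F // IsFacet P F}) where
  carrier := {I | ∃ x ∈ P, ∀ F ∈ I, x ∈ F.1}
  lower' := fun _ _ hle ⟨x, hx, h⟩ => ⟨x, hx, fun F hF => h F (hle hF)⟩

/-- The number of nonempty `k`-dimensional faces. -/
noncomputable def faceCount (P : Set (EuclideanSpace ℝ (Fin n))) (k : ℕ) : ℕ :=
  {F | IsFace P F ∧ F.Nonempty ∧ dim F = k}.ncard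

/-- Isomorphism of simplicial complexes in which every singleton of the base set is a face. -/
def ComplexIso {α β : Type*} (K : LowerSet (Finset α)) (L : LowerSet (Finset β)) : Prop :=
  ∃ e : α ≃ β, ∀ s : Finset α, s ∈ K ↔ s.map e.toEmbedding ∈ L

/-- `P` is an `n`-dimensional graph associahedron of `G`: a full-dimensional simple polyhedron in
`ℝⁿ` whose dual simplicial complex is isomorphic to the tubing complex of `G`. -/
def IsGraphAssociahedron {V : Type} [DecidableEq V] (G : DeltaGraph V)
    (P : Set (EuclideanSpace ℝ (Fin n))) : Prop :=
  IsPolyhedron P ∧ (interior P).Nonempty ∧ IsSimple P ∧ ComplexIso (dualComplex P) G.tubingComplex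

/-- The bivariate `f`-polynomial `∑ f_k(P_n) x^k y^n` of a family of polyhedra, as a power series in
`y` (outer variable) whose coefficients are power series in `x` (inner variable). -/
noncomputable def fSeries (P : (n : ℕ) → Set (EuclideanSpace ℝ (Fin n))) : ℚ⟦X⟧⟦X⟧ :=
  PowerSeries.mk fun n => PowerSeries.mk fun k => (faceCount (P n) k : ℚ)

/-- The variable `x`. -/
noncomputable def varX : ℚ⟦X⟧⟦X⟧ := PowerSeries.C PowerSeries.X

/-- The variable `y`. -/
noncomputable def varY : ℚ⟦X⟧⟦X⟧ := PowerSeries.X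

/-- The partial derivative `D_y`. -/
noncomputable def Dy (f : ℚ⟦X⟧⟦X⟧) : ℚ⟦X⟧⟦X⟧ := PowerSeries.derivative ℚ⟦X⟧ f

/-- The specialization `x = 0`. -/
noncomputable def atXZero (f : ℚ⟦X⟧⟦X⟧) : ℚ⟦X⟧ := PowerSeries.map PowerSeries.constantCoeff f

end Polyhedral

/-! ### Faces of a simple polyhedron and simplices of its dual complex. -/

namespace Polyhedral

variable {n : ℕ}

/-! The `k`-faces of an `n`-dimensional simple polyhedron correspond to the sets of `n - k` facets
with a common point (`faceCount_eq_ncard_dualComplex`), so every face number counts tubings with `n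
- k` tubes, and the geometry plays no further role.

Tubings are sorted by their union `U`, a face of the complex. With the weight of `U` defined as the
sum of `x ^ (|U| - |T|)` over the nests `T` with union `U`, the f-polynomial in dimension `n` is the
sum of `x ^ (n - |U|)` times the weight of `U` (`mk_faceCount`). Two rules determine all weights:
the weight is multiplicative over separated sets (`weight_union`), and a connected `U` belongs to
every nest with union `U`, so removing it expresses its weight through the proper subsets of `U`
(`weight_of_connected`). The second rule identifies the f-polynomials of the associahedron and the
cyclohedron with the weights of a path and of a cycle.

A face of the double cycle complex is a pair of disjoint subsets of one cycle. Fix a vertex of that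
cycle (`doubleCycleSum_succ`). If it lies in neither set, what remains is a pair of disjoint subsets
of a path, with a factor `x`. Otherwise, up to the symmetry responsible for the factor 2, it lies in
the first set. Either this set is the whole cycle, which gives the cyclohedron, or the vertex lies
in an arc bounded by two missing vertices, possibly equal. The complement of the arc is then a path
whose ends the first set avoids: a cis double path. An arc with `s` vertices has `s` positions
around the fixed vertex, which produces `1 + y D_y`.

It remains to see that the double path and the cycle have the same series
(`mk_doublePathSum_false_eq_cycleSeries`). Splitting off the last run of a pair gives a linear
system for the double path, arcs give a formula for the cycle, and both are rational in `W = y f^A`,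
`y W'`, `x` and `y`. The quadratic equation of `W` and its derivative make them agree. At `x = 0`
this quadratic becomes `W = y (1 + W)^2`, and `1 - 2 y (1 + W)` is the required square root. -/

/-- An irredundant description of a full-dimensional polyhedron by linear inequalities. -/
structure IrredundantDescription (P : Set (EuclideanSpace ℝ (Fin n)))
    (H : Finset (StrongDual ℝ (EuclideanSpace ℝ (Fin n)) × ℝ)) : Prop where
  mem_iff : ∀ x, x ∈ P ↔ ∀ h ∈ H, h.1 x ≤ h.2
  interior_point : ∃ z, ∀ h ∈ H, h.1 z < h.2
  facet_point : ∀ h ∈ H, ∃ w, h.1 w = h.2 ∧ ∀ h' ∈ H, h' ≠ h → h'.1 w < h'.2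

/-- A system minimal under inclusion works: each of its inequalities is violated by a point that
satisfies all the others. -/
theorem exists_irredundantDescription {P : Set (EuclideanSpace ℝ (Fin n))} (hP : IsPolyhedron P)
    (hint : (interior P).Nonempty) : ∃ H, IrredundantDescription P H := by
  obtain ⟨H, hH, hmin⟩ := wellFounded_lt.has_min
    {H : Finset (StrongDual ℝ (EuclideanSpace ℝ (Fin n)) × ℝ) | P = {x | ∀ h ∈ H, h.1 x ≤ h.2}} hP
  have hH' : ∀ x, x ∈ P ↔ ∀ h ∈ H, h.1 x ≤ h.2 := fun x => by
    rw [Set.mem_ofPred_eq] at hH; rw [hH]; rfl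
  obtain ⟨z, hz⟩ := hint
  classical
  have hviol : ∀ h ∈ H, ∃ y, h.2 < h.1 y ∧ ∀ h' ∈ H, h' ≠ h → h'.1 y ≤ h'.2 := by
    intro h hh
    by_contra hcon
    push Not at hcon
    refine hmin (H.erase h) ?_ (Finset.erase_ssubset hh)
    rw [Set.mem_ofPred_eq]
    ext x
    rw [hH' x, Set.mem_ofPred_eq]
    refine ⟨fun hx h' hh' => hx h' (Finset.mem_of_mem_erase hh'), fun hx h' hh' => ?_⟩
    by_cases heq : h' = h
    · subst heq
      by_contra hlt
      obtain ⟨h'', hm, hne, hgt⟩ := hcon x (not_le.mp hlt)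
      exact absurd (hx h'' (Finset.mem_erase.mpr ⟨hne, hm⟩)) (not_le.mpr hgt)
    · exact hx h' (Finset.mem_erase.mpr ⟨heq, hh'⟩)
  have hzP : z ∈ P := interior_subset hz
  have hstrict : ∀ h ∈ H, h.1 z < h.2 := by
    intro h hh
    refine lt_of_le_of_ne ((hH' z).mp hzP h hh) fun heq => ?_
    obtain ⟨y, hy, -⟩ := hviol h hh
    -- An inequality tight at the interior point `z` would already fail slightly towards `y`, inside
    -- `P`.
    have hcont : Filter.Tendsto (fun ε : ℝ => z + ε • (y - z)) (nhdsWithin 0 (Set.Ioi 0))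
        (nhds z) := by
      have : Continuous (fun ε : ℝ => z + ε • (y - z)) := by fun_prop
      have h0 := this.tendsto 0
      simp only [zero_smul, add_zero] at h0
      exact h0.mono_left nhdsWithin_le_nhds
    have hev := hcont.eventually (mem_interior_iff_mem_nhds.mp hz)
    obtain ⟨ε, hεP, hε⟩ := (hev.and self_mem_nhdsWithin).exists
    have h1 := (hH' _).mp hεP h hh
    simp only [map_add, map_smul, map_sub, smul_eq_mul] at h1
    have : 0 < ε * (h.1 y - h.1 z) := mul_pos hε (by linarith)
    linarith
  refine ⟨H, hH', ⟨z, hstrict⟩, fun h hh => ?_⟩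
  obtain ⟨y, hy, hy'⟩ := hviol h hh
  have hzs := hstrict h hh
  have hpos : 0 < h.1 y - h.1 z := by linarith
  -- The parameter at which the segment from `z` to `y` meets the hyperplane of `h`. Since `t < 1`,
  -- strictness at `z` keeps the other inequalities strict.
  set t := (h.2 - h.1 z) / (h.1 y - h.1 z) with ht
  have ht0 : 0 < t := div_pos (by linarith) hpos
  have ht1 : t < 1 := (div_lt_one hpos).mpr (by linarith)
  refine ⟨z + t • (y - z), ?_, fun h' hh' hne => ?_⟩
  · simp only [map_add, map_smul, map_sub, smul_eq_mul]
    rw [ht, div_mul_cancel₀ _ hpos.ne']; ring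
  · simp only [map_add, map_smul, map_sub, smul_eq_mul]
    have h1 := hstrict h' hh'
    have h2 := hy' h' hh' hne
    nlinarith

namespace IrredundantDescription

variable {P : Set (EuclideanSpace ℝ (Fin n))}
  {H : Finset (StrongDual ℝ (EuclideanSpace ℝ (Fin n)) × ℝ)}

/-- The inequalities that are tight at a point. -/
noncomputable def tight (H : Finset (StrongDual ℝ (EuclideanSpace ℝ (Fin n)) × ℝ))
    (x : EuclideanSpace ℝ (Fin n)) : Finset (StrongDual ℝ (EuclideanSpace ℝ (Fin n)) × ℝ) :=
  H.filter fun h => h.1 x = h.2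

theorem mem_tight {x : EuclideanSpace ℝ (Fin n)}
    {h : StrongDual ℝ (EuclideanSpace ℝ (Fin n)) × ℝ} :
    h ∈ tight H x ↔ h ∈ H ∧ h.1 x = h.2 := Finset.mem_filter

/-- The points of `P` at which all inequalities in `I` are tight. -/
def tightFace (P : Set (EuclideanSpace ℝ (Fin n)))
    (I : Finset (StrongDual ℝ (EuclideanSpace ℝ (Fin n)) × ℝ)) :
    Set (EuclideanSpace ℝ (Fin n)) := {x | x ∈ P ∧ ∀ h ∈ I, h.1 x = h.2}

theorem exists_step (D : IrredundantDescription P H) {x d : EuclideanSpace ℝ (Fin n)} (hx : x ∈ P)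
    (hd : ∀ h ∈ tight H x, h.1 d ≤ 0) :
    ∃ ε : ℝ, 0 < ε ∧ x + ε • d ∈ P ∧ ∀ h ∈ H, h ∉ tight H x → h.1 (x + ε • d) < h.2 := by
  have hev : ∀ᶠ ε : ℝ in nhdsWithin 0 (Set.Ioi 0), ∀ h ∈ H, h ∉ tight H x →
      h.1 (x + ε • d) < h.2 := by
    rw [Filter.eventually_all_finset]
    intro h hh
    by_cases hht : h ∈ tight H x
    · exact Filter.Eventually.of_forall fun _ h' => absurd hht h'
    have hlt : h.1 x < h.2 := lt_of_le_of_ne ((D.mem_iff x).mp hx h hh)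
      fun heq => hht (mem_tight.mpr ⟨hh, heq⟩)
    have hc : Continuous (fun ε : ℝ => h.1 (x + ε • d)) := by fun_prop
    have h0 := hc.tendsto 0
    simp only [zero_smul, add_zero] at h0
    exact ((h0.mono_left nhdsWithin_le_nhds).eventually (gt_mem_nhds hlt)).mono fun _ h' _ => h'
  obtain ⟨ε, hlt, hε⟩ := (hev.and self_mem_nhdsWithin).exists
  refine ⟨ε, hε, (D.mem_iff _).mpr fun h hh => ?_, hlt⟩
  by_cases hht : h ∈ tight H x
  · have h1 := hd h hht
    have h2 := (mem_tight.mp hht).2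
    simp only [map_add, map_smul, smul_eq_mul]
    have : ε * h.1 d ≤ 0 := mul_nonpos_of_nonneg_of_nonpos (le_of_lt hε) h1
    linarith
  · exact (hlt h hh hht).le

/-- The sum of the inequalities in `I` is valid on `P`, and equality in the sum forces equality in
each summand. -/
theorem isFace_tightFace (D : IrredundantDescription P H)
    {I : Finset (StrongDual ℝ (EuclideanSpace ℝ (Fin n)) × ℝ)} (hI : I ⊆ H) :
    IsFace P (tightFace P I) := by
  have key : ∀ x, (∑ h ∈ I, h.1) x = ∑ h ∈ I, h.1 x := fun x => by simp
  refine ⟨∑ h ∈ I, h.1, ∑ h ∈ I, h.2, fun x hx => ?_, ?_⟩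
  · rw [key]
    exact Finset.sum_le_sum fun h hh => (D.mem_iff x).mp hx h (hI hh)
  · ext x
    simp only [tightFace, Set.mem_ofPred_eq]
    refine and_congr_right fun hx => ?_
    rw [key, Finset.sum_eq_sum_iff_of_le fun h hh => (D.mem_iff x).mp hx h (hI hh)]

/-- A point of the face with the fewest tight inequalities plays the role of a relative interior
point: taking a midpoint with another point of the face could only remove tight inequalities. -/
theorem exists_eq_tightFace (D : IrredundantDescription P H) {F : Set (EuclideanSpace ℝ (Fin n))}
    (hF : IsFace P F) (hne : F.Nonempty) :
    ∃ x ∈ F, F = tightFace P (tight H x) := by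
  obtain ⟨c, b, hc, rfl⟩ := hF
  obtain ⟨x, hx, hmin⟩ := (measure fun x => (tight H x).card).wf.has_min _ hne
  refine ⟨x, hx, Set.Subset.antisymm (fun y hy => ⟨hy.1, fun h hh => ?_⟩) fun y hy => ⟨hy.1, ?_⟩⟩
  · by_contra hcon
    have hxs := (D.mem_iff x).mp hx.1
    have hys := (D.mem_iff y).mp hy.1
    have hmem : (1 / 2 : ℝ) • x + (1 / 2 : ℝ) • y ∈ {x | x ∈ P ∧ c x = b} := by
      refine ⟨(D.mem_iff _).mpr fun h' hh' => ?_, ?_⟩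
      · have h1 := hxs h' hh'
        have h2 := hys h' hh'
        simp only [map_add, map_smul, smul_eq_mul]; linarith
      · have h1 := hx.2
        have h2 := hy.2
        simp only [map_add, map_smul, smul_eq_mul]; linarith
    refine hmin _ hmem (Finset.card_lt_card ((Finset.ssubset_iff_of_subset fun h' hh' => ?_).mpr
      ⟨h, hh, fun hcon' => ?_⟩))
    · obtain ⟨hm, he⟩ := mem_tight.mp hh'
      have h1 := hxs h' hm
      have h2 := hys h' hm
      simp only [map_add, map_smul, smul_eq_mul] at he
      exact mem_tight.mpr ⟨hm, by linarith⟩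
    · obtain ⟨hm, he⟩ := mem_tight.mp hcon'
      have h1 := (mem_tight.mp hh).2
      simp only [map_add, map_smul, smul_eq_mul] at he
      exact hcon (by linarith)
  -- The segment from `y` to `x` can be prolonged beyond `x` within `P`. As `c` attains its bound at
  -- `x`, it cannot be smaller at `y`.
  · obtain ⟨ε, hε, hP', -⟩ := D.exists_step (d := x - y) hx.1 fun h hh => by
      have h1 := hy.2 h hh
      have h2 := (mem_tight.mp hh).2
      simp only [map_sub]; linarith
    have h1 := hc _ hP'
    have h2 := hc y hy.1
    have h3 := hx.2
    simp only [map_add, map_smul, map_sub, smul_eq_mul] at h1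
    have : ε * (c x - c y) ≤ 0 := by linarith
    have : c x - c y ≤ 0 := nonpos_of_mul_nonpos_right this hε
    linarith

/-- Evaluation of the functionals in `I`. -/
noncomputable def evalMap (I : Finset (StrongDual ℝ (EuclideanSpace ℝ (Fin n)) × ℝ)) :
    EuclideanSpace ℝ (Fin n) →ₗ[ℝ] (I → ℝ) :=
  LinearMap.pi fun h => (h.1.1 : EuclideanSpace ℝ (Fin n) →ₗ[ℝ] ℝ)

theorem mem_ker_evalMap {I : Finset (StrongDual ℝ (EuclideanSpace ℝ (Fin n)) × ℝ)}
    {v : EuclideanSpace ℝ (Fin n)} : v ∈ LinearMap.ker (evalMap I) ↔ ∀ h ∈ I, h.1 v = 0 := by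
  rw [LinearMap.mem_ker, funext_iff]
  exact ⟨fun h' h hh => h' ⟨h, hh⟩, fun h' h => h' h.1 h.2⟩

/-- Non-tight inequalities survive a short step, so every direction annihilated by the tight
functionals stays in the face. -/
theorem vectorSpan_tightFace (D : IrredundantDescription P H) {x : EuclideanSpace ℝ (Fin n)}
    (hx : x ∈ P) : vectorSpan ℝ (tightFace P (tight H x)) = LinearMap.ker (evalMap (tight H x)) := by
  apply le_antisymm
  · rw [vectorSpan_def, Submodule.span_le]
    rintro _ ⟨y, hy, y', hy', rfl⟩
    refine mem_ker_evalMap.mpr fun h hh => ?_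
    simp only [vsub_eq_sub, map_sub, hy.2 h hh, hy'.2 h hh, sub_self]
  · intro v hv
    rw [mem_ker_evalMap] at hv
    obtain ⟨ε, hε, hP', -⟩ := D.exists_step (d := v) hx fun h hh => (hv h hh).le
    have hxm : x ∈ tightFace P (tight H x) := ⟨hx, fun h hh => (mem_tight.mp hh).2⟩
    have hm : x + ε • v ∈ tightFace P (tight H x) := ⟨hP', fun h hh => by
      simp only [map_add, map_smul, hv h hh, (mem_tight.mp hh).2, smul_zero, add_zero]⟩
    have := vsub_mem_vectorSpan ℝ hm hxm
    rw [vsub_eq_sub, add_sub_cancel_left] at this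
    exact (Submodule.smul_mem_iff _ hε.ne').mp this

theorem dim_tightFace (D : IrredundantDescription P H) {x : EuclideanSpace ℝ (Fin n)}
    (hx : x ∈ P) : dim (tightFace P (tight H x)) +
      Module.finrank ℝ (LinearMap.range (evalMap (tight H x))) = n := by
  rw [dim, D.vectorSpan_tightFace hx, add_comm, LinearMap.finrank_range_add_finrank_ker,
    finrank_euclideanSpace_fin]

theorem facet_point_mem (D : IrredundantDescription P H)
    {h : StrongDual ℝ (EuclideanSpace ℝ (Fin n)) × ℝ} (hh : h ∈ H) :
    ∃ w ∈ P, tight H w = {h} := by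
  obtain ⟨w, hw, hw'⟩ := D.facet_point h hh
  refine ⟨w, (D.mem_iff w).mpr fun h' hh' => ?_, ?_⟩
  · by_cases heq : h' = h
    · rw [heq, hw]
    · exact (hw' h' hh' heq).le
  · ext h'
    rw [mem_tight, Finset.mem_singleton]
    refine ⟨fun hm => ?_, fun he => he ▸ ⟨hh, hw⟩⟩
    by_contra hne
    exact (hw' h' hm.1 hne).ne hm.2

theorem exists_pos (D : IrredundantDescription P H)
    {h : StrongDual ℝ (EuclideanSpace ℝ (Fin n)) × ℝ} (hh : h ∈ H) : ∃ v, h.1 v ≠ 0 := by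
  obtain ⟨z, hz⟩ := D.interior_point
  obtain ⟨w, hw, -⟩ := D.facet_point h hh
  refine ⟨w - z, ?_⟩
  have := hz h hh
  rw [map_sub, hw]
  exact (sub_pos.mpr this).ne'

theorem isFacet_tightFace_singleton (D : IrredundantDescription P H)
    {h : StrongDual ℝ (EuclideanSpace ℝ (Fin n)) × ℝ} (hh : h ∈ H) :
    IsFacet P (tightFace P {h}) := by
  obtain ⟨w, hw, ht⟩ := D.facet_point_mem hh
  have hdim := D.dim_tightFace hw
  rw [ht] at hdim
  refine ⟨D.isFace_tightFace (Finset.singleton_subset_iff.mpr hh), ⟨w, hw, fun h' hh' => ?_⟩, ?_⟩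
  · rw [← ht] at hh'
    exact (mem_tight.mp hh').2
  · have hle : Module.finrank ℝ (LinearMap.range (evalMap {h})) ≤ 1 := by
      refine (Submodule.finrank_le _).trans ?_
      simp
    have hpos : Module.finrank ℝ (LinearMap.range (evalMap {h})) ≠ 0 := by
      intro h0
      rw [Submodule.finrank_eq_zero, LinearMap.range_eq_bot] at h0
      obtain ⟨v, hv⟩ := D.exists_pos hh
      exact hv (mem_ker_evalMap.mp (by rw [h0, LinearMap.ker_zero]; trivial) h
        (Finset.mem_singleton_self h))
    omega

theorem isFacet_iff (D : IrredundantDescription P H) {G : Set (EuclideanSpace ℝ (Fin n))} :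
    IsFacet P G ↔ ∃ h ∈ H, G = tightFace P {h} := by
  refine ⟨fun ⟨hG, hne, hdim⟩ => ?_, fun ⟨h, hh, he⟩ => he ▸ D.isFacet_tightFace_singleton hh⟩
  obtain ⟨x, hx, hGx⟩ := D.exists_eq_tightFace hG hne
  have hxP : x ∈ P := by rw [hGx] at hx; exact hx.1
  have hd := D.dim_tightFace hxP
  rw [← hGx] at hd
  have hr : Module.finrank ℝ (LinearMap.range (evalMap (tight H x))) = 1 := by omega
  have hne' : (tight H x).Nonempty := by
    rw [Finset.nonempty_iff_ne_empty]
    intro h0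
    rw [h0] at hr
    have := Submodule.finrank_le (LinearMap.range (evalMap (n := n) ∅))
    simp at this
    rw [this] at hr
    simp at hr
  obtain ⟨h, hh⟩ := hne'
  have hhH := (mem_tight.mp hh).1
  refine ⟨h, hhH, ?_⟩
  rw [hGx]
  refine Set.Subset.antisymm (fun y hy => ⟨hy.1, fun h' hh' => ?_⟩)
    fun y hy => ⟨hy.1, fun h' hh' => ?_⟩
  · rw [Finset.mem_singleton] at hh'
    exact hh' ▸ hy.2 h hh
  -- Nested kernels, both of dimension `n - 1`: every functional tight at `x` is constant along the
  -- hyperplane of `h`.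
  · have hk : LinearMap.ker (evalMap (tight H x)) = LinearMap.ker (evalMap {h}) := by
      apply Submodule.eq_of_le_of_finrank_eq
      · intro v hv
        rw [mem_ker_evalMap] at hv ⊢
        intro h' hh'
        rw [Finset.mem_singleton] at hh'
        exact hh' ▸ hv h hh
      · obtain ⟨w, hw, ht⟩ := D.facet_point_mem hhH
        have h1 := D.vectorSpan_tightFace hw
        have h2 := (D.isFacet_tightFace_singleton hhH).2.2
        rw [ht] at h1
        rw [dim, h1] at h2
        rw [hGx, dim, D.vectorSpan_tightFace hxP] at hdim
        omega
    have hyx : y - x ∈ LinearMap.ker (evalMap {h}) := by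
      rw [mem_ker_evalMap]
      intro h'' hh''
      rw [Finset.mem_singleton] at hh''
      subst hh''
      rw [map_sub, hy.2 _ (Finset.mem_singleton_self _), (mem_tight.mp hh).2, sub_self]
    rw [← hk, mem_ker_evalMap] at hyx
    have := hyx h' hh'
    rw [map_sub, (mem_tight.mp hh').2] at this
    linarith

theorem tightFace_singleton_injOn (D : IrredundantDescription P H) :
    Set.InjOn (fun h => tightFace P {h}) (H : Set (StrongDual ℝ (EuclideanSpace ℝ (Fin n)) × ℝ)) := by
  intro h hh h' hh' he
  obtain ⟨w, hw, ht⟩ := D.facet_point_mem hh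
  have hwm : w ∈ tightFace P {h} := ⟨hw, fun h'' hm => by
    rw [← ht] at hm; exact (mem_tight.mp hm).2⟩
  simp only at he
  rw [he] at hwm
  have : h' ∈ tight H w := mem_tight.mpr ⟨hh', hwm.2 h' (Finset.mem_singleton_self _)⟩
  rw [ht, Finset.mem_singleton] at this
  exact this.symm

theorem ncard_facets (D : IrredundantDescription P H) {x : EuclideanSpace ℝ (Fin n)} (hx : x ∈ P) :
    {G | IsFacet P G ∧ tightFace P (tight H x) ⊆ G}.ncard = (tight H x).card := by
  have : {G | IsFacet P G ∧ tightFace P (tight H x) ⊆ G} =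
      (fun h => tightFace P {h}) '' (tight H x : Set _) := by
    ext G
    constructor
    · rintro ⟨hG, hsub⟩
      obtain ⟨h, hh, rfl⟩ := D.isFacet_iff.mp hG
      exact ⟨h, mem_tight.mpr ⟨hh, (hsub ⟨hx, fun h hh => (mem_tight.mp hh).2⟩).2 h
        (Finset.mem_singleton_self _)⟩, rfl⟩
    · rintro ⟨h, hh, rfl⟩
      refine ⟨D.isFacet_tightFace_singleton (mem_tight.mp hh).1, fun y hy => ⟨hy.1, fun h' hh' => ?_⟩⟩
      rw [Finset.mem_singleton] at hh'
      exact hh' ▸ hy.2 h hh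
  rw [this, Set.InjOn.ncard_image (D.tightFace_singleton_injOn.mono
    fun h hh => (mem_tight.mp hh).1), Set.ncard_coe_finset]

theorem dim_tightFace_add_card (D : IrredundantDescription P H) (hs : IsSimple P)
    {x : EuclideanSpace ℝ (Fin n)} (hx : x ∈ P) :
    dim (tightFace P (tight H x)) + (tight H x).card = n := by
  rw [← D.ncard_facets hx]
  exact hs _ (D.isFace_tightFace (Finset.filter_subset _ _))
    ⟨x, hx, fun h hh => (mem_tight.mp hh).2⟩

/-- Simplicity says that the codimension, which is the rank of the tight functionals, equals their
number; hence they are linearly independent. -/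
theorem evalMap_surjective (D : IrredundantDescription P H) (hs : IsSimple P)
    {x : EuclideanSpace ℝ (Fin n)} (hx : x ∈ P) :
    Function.Surjective (evalMap (tight H x)) := by
  rw [← LinearMap.range_eq_top]
  apply Submodule.eq_top_of_finrank_eq
  have h1 := D.dim_tightFace hx
  have h2 := D.dim_tightFace_add_card hs hx
  rw [Module.finrank_fintype_fun_eq_card, Fintype.card_coe]
  omega

/-- In a simple polyhedron every set of inequalities that are simultaneously tight somewhere
is the exact set of tight inequalities of some point. -/
theorem exists_tight_eq (D : IrredundantDescription P H) (hs : IsSimple P)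
    {I : Finset (StrongDual ℝ (EuclideanSpace ℝ (Fin n)) × ℝ)} (hI : I ⊆ H)
    (hne : (tightFace P I).Nonempty) : ∃ x ∈ P, tight H x = I := by
  classical
  obtain ⟨x, hx, hxI⟩ := hne
  -- By independence there is a direction that keeps the inequalities in `I` tight and relaxes all
  -- other tight ones.
  obtain ⟨d, hd⟩ := D.evalMap_surjective hs hx fun h => if h.1 ∈ I then 0 else -1
  have hd' : ∀ h ∈ tight H x, h.1 d = if h ∈ I then 0 else -1 :=
    fun h hh => congrFun hd ⟨h, hh⟩
  obtain ⟨ε, hε, hP', hlt⟩ := D.exists_step (d := d) hx fun h hh => by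
    rw [hd' h hh]; split_ifs <;> norm_num
  refine ⟨_, hP', ?_⟩
  ext h
  rw [mem_tight]
  constructor
  · rintro ⟨hh, he⟩
    by_cases hht : h ∈ tight H x
    · by_contra hnI
      have := hd' h hht
      rw [if_neg hnI] at this
      simp only [map_add, map_smul, this, smul_eq_mul, (mem_tight.mp hht).2] at he
      linarith
    · exact absurd he (hlt h hh hht).ne
  · intro hh
    have hht : h ∈ tight H x := mem_tight.mpr ⟨hI hh, hxI h hh⟩
    have := hd' h hht
    rw [if_pos hh] at this
    exact ⟨hI hh, by simp only [map_add, map_smul, this, smul_zero, add_zero, hxI h hh]⟩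

end IrredundantDescription

open IrredundantDescription in
/-- The nonempty faces of a simple polyhedron correspond to the simplices of its dual complex. -/
theorem faceCount_eq_ncard_dualComplex {P : Set (EuclideanSpace ℝ (Fin n))} (hP : IsPolyhedron P)
    (hint : (interior P).Nonempty) (hs : IsSimple P) (k : ℕ) :
    faceCount P k = {I | I ∈ dualComplex P ∧ I.card + k = n}.ncard := by
  classical
  obtain ⟨H, D⟩ := exists_irredundantDescription hP hint
  -- From here on a facet is replaced by its defining inequality, so that sets of facets become sets
  -- of inequalities.
  have hcover : ∀ F : {F // IsFacet P F}, ∃ h ∈ H, F.1 = tightFace P {h} :=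
    fun F => D.isFacet_iff.mp F.2
  choose φ hφH hφ using hcover
  have hφinj : Function.Injective φ := fun F F' he => Subtype.ext (by rw [hφ F, hφ F', he])
  have hmem : ∀ (J : Finset {F // IsFacet P F}) (x : EuclideanSpace ℝ (Fin n)), x ∈ P →
      ((∀ F ∈ J, x ∈ F.1) ↔ x ∈ tightFace P (J.image φ)) := by
    intro J x hx
    constructor
    · refine fun h => ⟨hx, fun h' hh' => ?_⟩
      obtain ⟨F, hF, rfl⟩ := Finset.mem_image.mp hh'
      have := h F hF
      rw [hφ F] at this
      exact this.2 _ (Finset.mem_singleton_self _)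
    · intro h F hF
      rw [hφ F]
      refine ⟨hx, fun h' hh' => ?_⟩
      rw [Finset.mem_singleton.mp hh']
      exact h.2 _ (Finset.mem_image_of_mem φ hF)
  have hJH : ∀ J : Finset {F // IsFacet P F}, J.image φ ⊆ H := fun J h hh => by
    obtain ⟨F, hF, rfl⟩ := Finset.mem_image.mp hh
    exact hφH F
  have hJ : ∀ J ∈ dualComplex P, ∃ x ∈ P, tight H x = J.image φ := by
    rintro J ⟨x, hx, hxJ⟩
    exact D.exists_tight_eq hs (hJH J) ⟨x, (hmem J x hx).mp hxJ⟩
  have himg : {F | IsFace P F ∧ F.Nonempty ∧ dim F = k} =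
      (fun J : Finset {F // IsFacet P F} => tightFace P (J.image φ)) ''
        {I | I ∈ dualComplex P ∧ I.card + k = n} := by
    ext F
    constructor
    · rintro ⟨hF, hne, hdim⟩
      obtain ⟨x, hx, hFx⟩ := D.exists_eq_tightFace hF hne
      have hxP : x ∈ P := by rw [hFx] at hx; exact hx.1
      set J : Finset {F // IsFacet P F} := (tight H x).attach.image
        fun h => ⟨tightFace P {h.1}, D.isFacet_tightFace_singleton (mem_tight.mp h.2).1⟩ with hJdef
      have hφJ : J.image φ = tight H x := by
        have hval : ∀ h : {h // h ∈ tight H x}, φ ⟨tightFace P {h.1},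
            D.isFacet_tightFace_singleton (mem_tight.mp h.2).1⟩ = h.1 := fun h =>
          D.tightFace_singleton_injOn (hφH _) (mem_tight.mp h.2).1 (hφ _).symm
        ext h
        simp only [hJdef, Finset.mem_image, Finset.mem_attach, true_and]
        constructor
        · rintro ⟨_, ⟨h', rfl⟩, rfl⟩
          rw [hval]; exact h'.2
        · exact fun hh => ⟨_, ⟨⟨h, hh⟩, rfl⟩, hval ⟨h, hh⟩⟩
      refine ⟨J, ⟨⟨x, hxP, (hmem J x hxP).mpr ?_⟩, ?_⟩, ?_⟩
      · rw [hφJ]; rw [hFx] at hx; exact hx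
      · have := D.dim_tightFace_add_card hs hxP
        rw [← Finset.card_image_of_injective J hφinj, hφJ, ← hdim]
        rw [← hFx] at this
        omega
      · simp only [hφJ, hFx]
    · rintro ⟨J, ⟨hJd, hcard⟩, rfl⟩
      obtain ⟨x, hx, ht⟩ := hJ J hJd
      have := D.dim_tightFace_add_card hs hx
      rw [ht, Finset.card_image_of_injective J hφinj] at this
      refine ⟨D.isFace_tightFace (hJH J), ⟨x, hx, fun h hh => ?_⟩, by simp only; omega⟩
      rw [← ht] at hh
      exact (mem_tight.mp hh).2
  rw [faceCount, himg, Set.InjOn.ncard_image]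
  -- For injectivity, a point whose tight set is exactly `J.image φ` detects every facet that
  -- contains the face.
  have hle : ∀ J ∈ dualComplex P, ∀ J', tightFace P (J.image φ) = tightFace P (J'.image φ) →
      J' ⊆ J := by
    intro J hJd J' he
    obtain ⟨x, hx, ht⟩ := hJ J hJd
    have hxm : x ∈ tightFace P (J.image φ) := ⟨hx, fun h hh => by
      rw [← ht] at hh; exact (mem_tight.mp hh).2⟩
    rw [he] at hxm
    rw [← Finset.image_subset_image_iff hφinj, ← ht]
    exact fun h hh => mem_tight.mpr ⟨hJH J' hh, hxm.2 h hh⟩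
  exact fun J hJd J' hJd' he => (hle J' hJd'.1 J he.symm).antisymm (hle J hJd.1 J' he)

theorem ComplexIso.ncard_eq {α β : Type*} {K : LowerSet (Finset α)} {L : LowerSet (Finset β)}
    (h : ComplexIso K L) (p : ℕ → Prop) :
    {I | I ∈ K ∧ p I.card}.ncard = {J | J ∈ L ∧ p J.card}.ncard := by
  obtain ⟨e, he⟩ := h
  have : {J | J ∈ L ∧ p J.card} = (fun s : Finset α => s.map e.toEmbedding) ''
      {I | I ∈ K ∧ p I.card} := by
    ext J
    constructor
    · rintro ⟨hJ, hp⟩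
      have hJ' : (J.map e.symm.toEmbedding).map e.toEmbedding = J := by
        rw [Finset.map_map]
        convert Finset.map_refl
        ext; simp
      refine ⟨J.map e.symm.toEmbedding, ⟨(he _).mpr ?_, ?_⟩, hJ'⟩
      · rwa [hJ']
      · rwa [Finset.card_map]
    · rintro ⟨I, ⟨hI, hp⟩, rfl⟩
      exact ⟨(he I).mp hI, by rwa [Finset.card_map]⟩
  rw [this, Set.ncard_image_of_injective _ (Finset.map_injective _)]

/-- The number of `k`-dimensional faces of an `n`-dimensional graph associahedron is the number of
tubings with `n - k` tubes. -/
theorem IsGraphAssociahedron.faceCount_eq {V : Type} [DecidableEq V] {G : DeltaGraph V}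
    {P : Set (EuclideanSpace ℝ (Fin n))} (h : IsGraphAssociahedron G P) (k : ℕ) :
    faceCount P k = {T | G.IsTubing T ∧ T.card + k = n}.ncard := by
  obtain ⟨hP, hint, hs, hiso⟩ := h
  rw [faceCount_eq_ncard_dualComplex hP hint hs]
  exact hiso.ncard_eq fun m => m + k = n

end Polyhedral

/-! ### Nests of connected sets and their weights -/

namespace SimpleGraph

variable {V W : Type*} {H : SimpleGraph V} {H' : SimpleGraph W}

/-- Finite sets that are nested, or disjoint and not joined by an edge. -/
def Compat (H : SimpleGraph V) (s t : Finset V) : Prop :=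
  s ⊆ t ∨ t ⊆ s ∨ (Disjoint s t ∧ ∀ u ∈ s, ∀ v ∈ t, ¬ H.Adj u v)

/-- A set of pairwise weakly compatible connected sets. -/
def IsNest (H : SimpleGraph V) (T : Finset (Finset V)) : Prop :=
  (∀ t ∈ T, (H.induce (t : Set V)).Connected) ∧ ∀ s ∈ T, ∀ t ∈ T, H.Compat s t

/-- Two sets are separated if they are disjoint and not joined by an edge. -/
def Separated (H : SimpleGraph V) (A B : Finset V) : Prop :=
  Disjoint A B ∧ ∀ u ∈ A, ∀ v ∈ B, ¬ H.Adj u v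

theorem Separated.symm {A B : Finset V} (h : H.Separated A B) : H.Separated B A :=
  ⟨h.1.symm, fun u hu v hv huv => h.2 v hv u hu huv.symm⟩

theorem Separated.mono {A B A' B' : Finset V} (h : H.Separated A B) (hA : A' ⊆ A) (hB : B' ⊆ B) :
    H.Separated A' B' :=
  ⟨h.1.mono hA hB, fun u hu v hv => h.2 u (hA hu) v (hB hv)⟩

theorem nonempty_of_connected_induce {t : Finset V} (h : (H.induce (t : Set V)).Connected) :
    t.Nonempty := by
  obtain ⟨x⟩ := h.nonempty
  exact ⟨x.1, x.2⟩

theorem Walk.mem_of_closed {S : Set V} (hS : ∀ u ∈ S, ∀ v, H.Adj u v → v ∈ S) {u v : V}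
    (p : H.Walk u v) (hu : u ∈ S) : v ∈ S := by
  induction p with
  | nil => exact hu
  | cons h _ ih => exact ih (hS _ hu _ h)

theorem subset_or_subset_of_connected [DecidableEq V] {t A B : Finset V}
    (ht : (H.induce (t : Set V)).Connected) (hsub : t ⊆ A ∪ B) (hAB : H.Separated A B) :
    t ⊆ A ∨ t ⊆ B := by
  obtain ⟨a, ha⟩ := nonempty_of_connected_induce ht
  have key : ∀ A' B' : Finset V, t ⊆ A' ∪ B' → H.Separated A' B' → a ∈ A' → t ⊆ A' := by
    intro A' B' hsub' hsep haA b hb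
    obtain ⟨p⟩ := ht.preconnected ⟨a, ha⟩ ⟨b, hb⟩
    refine p.mem_of_closed (S := {v : (t : Set V) | v.1 ∈ A'}) (fun u hu v huv => ?_) haA
    rcases Finset.mem_union.mp (hsub' v.2) with h | h
    · exact h
    · exact absurd huv (hsep.2 _ hu _ h)
  rcases Finset.mem_union.mp (hsub ha) with h | h
  · exact Or.inl (key A B hsub hAB h)
  · exact Or.inr (key B A (by rwa [Finset.union_comm]) hAB.symm h)

theorem IsNest.mono {T T' : Finset (Finset V)} (h : H.IsNest T) (hT : T' ⊆ T) : H.IsNest T' :=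
  ⟨fun t ht => h.1 t (hT ht), fun s hs t ht => h.2 s (hT hs) t (hT ht)⟩

/-- A member of largest cardinality lies properly in no other member, so compatibility leaves only
subsets of it and sets separated from it. -/
theorem IsNest.exists_maximal [DecidableEq V] {T : Finset (Finset V)} (h : H.IsNest T)
    (hne : T.Nonempty) :
    ∃ t ∈ T, H.Separated t ((T.filter fun s => ¬ s ⊆ t).biUnion id) := by
  obtain ⟨t, ht, hmax⟩ := T.exists_max_image Finset.card hne
  have key : ∀ s ∈ T, ¬ s ⊆ t → H.Separated t s := by
    intro s hs hst
    rcases h.2 t ht s hs with h1 | h1 | h1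
    · exact absurd (Finset.eq_of_subset_of_card_le h1 (hmax s hs)).symm.subset hst
    · exact absurd h1 hst
    · exact h1
  refine ⟨t, ht, ?_, fun u hu v hv => ?_⟩
  · rw [Finset.disjoint_biUnion_right]
    intro s hs
    rw [Finset.mem_filter] at hs
    exact (key s hs.1 hs.2).1
  · obtain ⟨s, hs, hv⟩ := Finset.mem_biUnion.mp hv
    rw [Finset.mem_filter] at hs
    exact (key s hs.1 hs.2).2 u hu v hv

/-- A connected union cannot split into a maximal member and a nonempty part separated from it, so
it equals that member. -/
theorem IsNest.biUnion_mem [DecidableEq V] {T : Finset (Finset V)} (h : H.IsNest T)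
    (hc : (H.induce ((T.biUnion id : Finset V) : Set V)).Connected) : T.biUnion id ∈ T := by
  obtain ⟨v, hv⟩ := nonempty_of_connected_induce hc
  obtain ⟨s, hs, -⟩ := Finset.mem_biUnion.mp hv
  obtain ⟨t, ht, hsep⟩ := h.exists_maximal ⟨s, hs⟩
  have hsub : T.biUnion id ⊆ t ∪ (T.filter fun s => ¬ s ⊆ t).biUnion id := by
    refine Finset.biUnion_subset.mpr fun s hs => ?_
    by_cases hst : s ⊆ t
    · exact hst.trans Finset.subset_union_left
    · exact (Finset.subset_biUnion_of_mem id (Finset.mem_filter.mpr ⟨hs, hst⟩)).trans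
        Finset.subset_union_right
  have htU : t ⊆ T.biUnion id := Finset.subset_biUnion_of_mem id ht
  rcases subset_or_subset_of_connected hc hsub hsep with h1 | h1
  · rwa [h1.antisymm htU]
  · obtain ⟨a, ha⟩ := nonempty_of_connected_induce (h.1 t ht)
    exact absurd (h1 (htU ha)) (Finset.disjoint_left.mp hsep.1 ha)

/-- This bound makes the truncated subtraction `|U| - |T|` in the weights a genuine one. -/
theorem IsNest.card_le [DecidableEq V] {T : Finset (Finset V)} (h : H.IsNest T) :
    T.card ≤ (T.biUnion id).card := by
  induction hN : T.card using Nat.strong_induction_on generalizing T with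
  | _ N ih =>
    subst hN
    rcases T.eq_empty_or_nonempty with rfl | hne
    · simp
    obtain ⟨t, ht, hsep⟩ := h.exists_maximal hne
    by_cases hall : ∀ s ∈ T, s ⊆ t
    · have hU : T.biUnion id = t := (Finset.biUnion_subset.mpr hall).antisymm
        (Finset.subset_biUnion_of_mem id ht)
      have hlt : (T.erase t).card < T.card := Finset.card_erase_lt_of_mem ht
      have hN' : H.IsNest (T.erase t) := h.mono (Finset.erase_subset _ _)
      have h1 := ih _ hlt hN' rfl
      have hssub : (T.erase t).biUnion id ⊂ t := by
        refine Finset.ssubset_iff_subset_ne.mpr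
          ⟨Finset.biUnion_subset.mpr fun s hs => hall s (Finset.mem_of_mem_erase hs), fun he => ?_⟩
        -- If erasing the top set `t` left the union unchanged, that union would be connected and
        -- hence still a member.
        have := hN'.biUnion_mem (by rw [he]; exact h.1 t ht)
        rw [he] at this
        exact Finset.notMem_erase t T this
      have h2 := Finset.card_lt_card hssub
      have h3 := Finset.card_erase_add_one ht
      rw [hU]
      omega
    · push Not at hall
      obtain ⟨s, hs, hst⟩ := hall
      have hsplit := Finset.card_filter_add_card_filter_not (s := T) (fun s => s ⊆ t)
      have hpos1 : 0 < (T.filter fun s => ¬ s ⊆ t).card :=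
        Finset.card_pos.mpr ⟨s, Finset.mem_filter.mpr ⟨hs, hst⟩⟩
      have hpos2 : 0 < (T.filter fun s => s ⊆ t).card :=
        Finset.card_pos.mpr ⟨t, Finset.mem_filter.mpr ⟨ht, subset_rfl⟩⟩
      have h1 := ih (T.filter fun s => s ⊆ t).card (by omega) (h.mono (Finset.filter_subset _ _)) rfl
      have h2 := ih (T.filter fun s => ¬ s ⊆ t).card (by omega)
        (h.mono (Finset.filter_subset _ _)) rfl
      have h3 : ((T.filter fun s => s ⊆ t).biUnion id).card ≤ t.card :=
        Finset.card_le_card (Finset.biUnion_subset.mpr fun s hs => (Finset.mem_filter.mp hs).2)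
      have h4 : (t ∪ (T.filter fun s => ¬ s ⊆ t).biUnion id).card ≤ (T.biUnion id).card :=
        Finset.card_le_card (Finset.union_subset (Finset.subset_biUnion_of_mem id ht)
          (Finset.biUnion_subset_biUnion_of_subset_left _ (Finset.filter_subset _ _)))
      rw [Finset.card_union_of_disjoint hsep.1] at h4
      omega

open Classical in
/-- The nests with union `U`. -/
noncomputable def nests (H : SimpleGraph V) (U : Finset V) : Finset (Finset (Finset V)) :=
  U.powerset.powerset.filter fun T => H.IsNest T ∧ ∀ v, v ∈ U ↔ ∃ t ∈ T, v ∈ t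

theorem mem_nests [DecidableEq V] {U : Finset V} {T : Finset (Finset V)} :
    T ∈ H.nests U ↔ H.IsNest T ∧ T.biUnion id = U := by
  classical
  have hiff : T.biUnion id = U ↔ ∀ v, v ∈ U ↔ ∃ t ∈ T, v ∈ t := by
    rw [Finset.ext_iff]
    exact forall_congr' fun v => by rw [Finset.mem_biUnion]; exact Iff.comm
  rw [nests, Finset.mem_filter, hiff]
  refine ⟨And.right, fun h => ⟨?_, h⟩⟩
  rw [Finset.mem_powerset]
  intro t ht
  rw [Finset.mem_powerset]
  exact fun v hv => (h.2 v).mpr ⟨t, ht, hv⟩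

theorem card_le_of_mem_nests {U : Finset V} {T : Finset (Finset V)}
    (h : T ∈ H.nests U) : T.card ≤ U.card := by
  classical
  rw [mem_nests] at h
  exact h.1.card_le.trans_eq (by rw [h.2])

/-! ### Weights of vertex sets: multiplicativity, recursion and invariance. -/

section Weight

variable {R : Type*} [CommSemiring R] (x : R)

/-- The generating polynomial of the nests with union `U`. -/
noncomputable def weight (H : SimpleGraph V) (U : Finset V) : R :=
  ∑ T ∈ H.nests U, x ^ (U.card - T.card)

theorem weight_empty : weight x H ∅ = 1 := by
  classical
  have : H.nests ∅ = {∅} := by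
    ext T
    rw [mem_nests, Finset.mem_singleton]
    constructor
    · rintro ⟨hT, hU⟩
      rw [Finset.eq_empty_iff_forall_notMem]
      intro t ht
      obtain ⟨v, hv⟩ := nonempty_of_connected_induce (hT.1 t ht)
      have := Finset.subset_biUnion_of_mem id ht hv
      rw [hU] at this
      exact Finset.notMem_empty _ this
    · rintro rfl
      exact ⟨⟨by simp, by simp⟩, by simp⟩
  rw [weight, this]
  simp

/-- A connected set inside `A ∪ B` lies in one of the two parts, so a nest splits uniquely;
conversely, sets from the two parts are always compatible. -/
theorem weight_union [DecidableEq V] {A B : Finset V} (hAB : H.Separated A B) :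
    weight x H (A ∪ B) = weight x H A * weight x H B := by
  have hne : ∀ {T : Finset (Finset V)}, H.IsNest T → ∀ t ∈ T, t ⊆ A → t ⊆ B → False := by
    intro T hT t ht h1 h2
    obtain ⟨v, hv⟩ := nonempty_of_connected_induce (hT.1 t ht)
    exact Finset.disjoint_left.mp hAB.1 (h1 hv) (h2 hv)
  have hsub : ∀ {U : Finset V} {T : Finset (Finset V)}, T ∈ H.nests U → ∀ t ∈ T, t ⊆ U := by
    intro U T hT t ht
    rw [← (mem_nests.mp hT).2]
    exact Finset.subset_biUnion_of_mem id ht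
  rw [weight, weight, weight, Finset.sum_mul_sum, ← Finset.sum_product']
  refine Finset.sum_nbij' (fun T => (T.filter (· ⊆ A), T.filter (· ⊆ B))) (fun p => p.1 ∪ p.2)
    ?_ ?_ ?_ ?_ ?_
  · intro T hT
    have hTU := hsub hT
    rw [mem_nests] at hT
    have hor : ∀ t ∈ T, t ⊆ A ∨ t ⊆ B := fun t ht =>
      subset_or_subset_of_connected (hT.1.1 t ht) (hTU t ht) hAB
    rw [Finset.mem_product, mem_nests, mem_nests]
    refine ⟨⟨hT.1.mono (Finset.filter_subset _ _), ?_⟩, hT.1.mono (Finset.filter_subset _ _), ?_⟩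
    · refine (Finset.biUnion_subset.mpr fun s hs => (Finset.mem_filter.mp hs).2).antisymm
        fun v hv => ?_
      have hvU : v ∈ T.biUnion id := by rw [hT.2]; exact Finset.mem_union_left _ hv
      obtain ⟨t, ht, hvt⟩ := Finset.mem_biUnion.mp hvU
      refine Finset.mem_biUnion.mpr ⟨t, Finset.mem_filter.mpr ⟨ht, (hor t ht).resolve_right ?_⟩, hvt⟩
      exact fun h => Finset.disjoint_left.mp hAB.1 hv (h hvt)
    · refine (Finset.biUnion_subset.mpr fun s hs => (Finset.mem_filter.mp hs).2).antisymm
        fun v hv => ?_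
      have hvU : v ∈ T.biUnion id := by rw [hT.2]; exact Finset.mem_union_right _ hv
      obtain ⟨t, ht, hvt⟩ := Finset.mem_biUnion.mp hvU
      refine Finset.mem_biUnion.mpr ⟨t, Finset.mem_filter.mpr ⟨ht, (hor t ht).resolve_left ?_⟩, hvt⟩
      exact fun h => Finset.disjoint_left.mp hAB.1 (h hvt) hv
  · rintro ⟨T₁, T₂⟩ hT
    rw [Finset.mem_product] at hT
    have hs1 := hsub hT.1
    have hs2 := hsub hT.2
    simp only [mem_nests] at hT ⊢
    refine ⟨⟨fun t ht => ?_, fun s hs t ht => ?_⟩, ?_⟩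
    · rcases Finset.mem_union.mp ht with h | h
      · exact hT.1.1.1 t h
      · exact hT.2.1.1 t h
    · rcases Finset.mem_union.mp ht with h | h <;> rcases Finset.mem_union.mp hs with h' | h'
      · exact hT.1.1.2 s h' t h
      · exact Or.inr (Or.inr (hAB.symm.mono (hs2 s h') (hs1 t h)))
      · exact Or.inr (Or.inr (hAB.mono (hs1 s h') (hs2 t h)))
      · exact hT.2.1.2 s h' t h
    · rw [Finset.union_biUnion, hT.1.2, hT.2.2]
  · intro T hT
    have hTU := hsub hT
    rw [mem_nests] at hT
    simp only
    rw [← Finset.filter_or, Finset.filter_eq_self]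
    exact fun t ht => subset_or_subset_of_connected (hT.1.1 t ht) (hTU t ht) hAB
  · rintro ⟨T₁, T₂⟩ hT
    rw [Finset.mem_product] at hT
    have hs1 := hsub hT.1
    have hs2 := hsub hT.2
    simp only [mem_nests] at hT
    simp only [Finset.filter_union, Prod.mk.injEq]
    rw [Finset.filter_eq_self.mpr hs1, Finset.filter_eq_self.mpr hs2,
      Finset.filter_eq_empty_iff.mpr fun t ht h => hne hT.2.1 t ht h (hs2 t ht),
      Finset.filter_eq_empty_iff.mpr fun t ht h => hne hT.1.1 t ht (hs1 t ht) h,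
      Finset.union_empty, Finset.empty_union]
    exact ⟨rfl, rfl⟩
  · intro T hT
    have hTU := hsub hT
    rw [mem_nests] at hT
    have hor : ∀ t ∈ T, t ⊆ A ∨ t ⊆ B := fun t ht =>
      subset_or_subset_of_connected (hT.1.1 t ht) (hTU t ht) hAB
    have h1 : (T.filter (· ⊆ A)).card ≤ A.card :=
      (hT.1.mono (Finset.filter_subset _ _)).card_le.trans (Finset.card_le_card
        (Finset.biUnion_subset.mpr fun s hs => (Finset.mem_filter.mp hs).2))
    have h2 : (T.filter (· ⊆ B)).card ≤ B.card :=
      (hT.1.mono (Finset.filter_subset _ _)).card_le.trans (Finset.card_le_card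
        (Finset.biUnion_subset.mpr fun s hs => (Finset.mem_filter.mp hs).2))
    have h3 : T.card = (T.filter (· ⊆ A)).card + (T.filter (· ⊆ B)).card := by
      rw [← Finset.card_union_of_disjoint, ← Finset.filter_or, Finset.filter_eq_self.mpr hor]
      rw [Finset.disjoint_filter]
      exact fun t ht => hne hT.1 t ht
    simp only
    rw [← pow_add, Finset.card_union_of_disjoint hAB.1]
    congr 1
    omega

/-- Every nest with union `U` contains `U`. Erasing it leaves an arbitrary nest with a smaller union
`U'`, and the exponent splits as `(|U| - 1 - |U'|) + (|U'| - |T'|)`. -/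
theorem weight_of_connected [DecidableEq V] {U : Finset V}
    (hU : (H.induce (U : Set V)).Connected) :
    weight x H U = ∑ U' ∈ U.ssubsets, x ^ (U.card - 1 - U'.card) * weight x H U' := by
  simp only [weight, Finset.mul_sum]
  rw [Finset.sum_sigma']
  have hssub : ∀ {T : Finset (Finset V)}, H.IsNest T → T.biUnion id ⊆ U → U ∉ T →
      T.biUnion id ⊂ U := fun hT hs hn => Finset.ssubset_iff_subset_ne.mpr
    ⟨hs, fun he => hn (he ▸ hT.biUnion_mem (by rw [he]; exact hU))⟩
  have hErase : ∀ T ∈ H.nests U, U ∈ T ∧ (T.erase U).biUnion id ⊂ U := by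
    intro T hT
    rw [mem_nests] at hT
    refine ⟨?_, hssub (hT.1.mono (Finset.erase_subset _ _)) ?_ (Finset.notMem_erase _ _)⟩
    · have := hT.1.biUnion_mem (by rw [hT.2]; exact hU)
      rwa [hT.2] at this
    · exact (Finset.biUnion_subset_biUnion_of_subset_left _ (Finset.erase_subset _ _)).trans_eq hT.2
  have hnot : ∀ {U' : Finset V} {T : Finset (Finset V)}, U' ⊂ U → T ∈ H.nests U' → U ∉ T := by
    intro U' T hU' hT hmem
    rw [mem_nests] at hT
    have := Finset.subset_biUnion_of_mem id hmem
    rw [hT.2] at this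
    exact hU'.2 this
  refine Finset.sum_bij' (fun T _ => ⟨(T.erase U).biUnion id, T.erase U⟩)
    (fun p _ => insert U p.2) ?_ ?_ ?_ ?_ ?_
  · intro T hT
    rw [Finset.mem_sigma, Finset.mem_ssubsets]
    refine ⟨(hErase T hT).2, mem_nests.mpr ⟨?_, rfl⟩⟩
    exact (mem_nests.mp hT).1.mono (Finset.erase_subset _ _)
  · rintro ⟨U', T⟩ hp
    rw [Finset.mem_sigma, Finset.mem_ssubsets] at hp
    obtain ⟨hU', hT⟩ := hp
    simp only [mem_nests] at hU' hT ⊢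
    have hsub : ∀ t ∈ T, t ⊆ U := fun t ht =>
      (Finset.subset_biUnion_of_mem id ht).trans (hT.2.subset.trans hU'.1)
    refine ⟨⟨fun t ht => ?_, fun s hs t ht => ?_⟩, ?_⟩
    · rcases Finset.mem_insert.mp ht with rfl | h
      · exact hU
      · exact hT.1.1 t h
    · rcases Finset.mem_insert.mp ht with rfl | h
      · rcases Finset.mem_insert.mp hs with rfl | h'
        · exact Or.inl subset_rfl
        · exact Or.inl (hsub s h')
      · rcases Finset.mem_insert.mp hs with rfl | h'
        · exact Or.inr (Or.inl (hsub t h))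
        · exact hT.1.2 s h' t h
    · rw [Finset.biUnion_insert, hT.2, id]
      exact Finset.union_eq_left.mpr hU'.1
  · intro T hT
    exact Finset.insert_erase (hErase T hT).1
  · rintro ⟨U', T⟩ hp
    rw [Finset.mem_sigma, Finset.mem_ssubsets] at hp
    have he : (insert U T).erase U = T := Finset.erase_insert (hnot hp.1 hp.2)
    have h2 := (mem_nests.mp hp.2).2
    simp only at h2
    simp only [he, h2]
  · intro T hT
    have hmem := hErase T hT
    have h1 : (T.erase U).card ≤ ((T.erase U).biUnion id).card :=
      ((mem_nests.mp hT).1.mono (Finset.erase_subset _ _)).card_le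
    have h2 := Finset.card_lt_card hmem.2
    have h3 := Finset.card_erase_add_one hmem.1
    simp only
    rw [← pow_add]
    congr 1
    omega

theorem connected_induce_image_iff [DecidableEq W] {f : V → W} {t : Finset V}
    (hf : Set.InjOn f t) (hadj : ∀ u ∈ t, ∀ v ∈ t, H'.Adj (f u) (f v) ↔ H.Adj u v) :
    (H'.induce ((t.image f : Finset W) : Set W)).Connected ↔ (H.induce (t : Set V)).Connected := by
  rw [Finset.coe_image]
  refine (Iso.connected_iff ⟨Equiv.Set.imageOfInjOn f t hf, ?_⟩).symm
  intro u v
  exact hadj u.1 u.2 v.1 v.2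

theorem compat_image_iff [DecidableEq W] {f : V → W} {U s t : Finset V} (hf : Set.InjOn f U)
    (hadj : ∀ u ∈ U, ∀ v ∈ U, H'.Adj (f u) (f v) ↔ H.Adj u v) (hs : s ⊆ U) (ht : t ⊆ U) :
    H'.Compat (s.image f) (t.image f) ↔ H.Compat s t := by
  have hsub : ∀ {s t : Finset V}, s ⊆ U → t ⊆ U → (s.image f ⊆ t.image f ↔ s ⊆ t) := by
    intro s t hs ht
    refine ⟨fun h v hv => ?_, Finset.image_subset_image⟩
    obtain ⟨u, hu, he⟩ := Finset.mem_image.mp (h (Finset.mem_image_of_mem f hv))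
    rwa [← hf (ht hu) (hs hv) he]
  unfold Compat
  rw [hsub hs ht, hsub ht hs]
  refine or_congr_right (or_congr_right (and_congr ?_ ?_))
  · simp only [Finset.disjoint_left, Finset.mem_image]
    constructor
    · exact fun h v hv hv' => h ⟨v, hv, rfl⟩ ⟨v, hv', rfl⟩
    · rintro h _ ⟨v, hv, rfl⟩ ⟨u, hu, he⟩
      rw [hf (ht hu) (hs hv) he] at hu
      exact h hv hu
  · simp only [Finset.forall_mem_image]
    exact forall₂_congr fun u hu => forall₂_congr fun v hv => not_congr (hadj u (hs hu) v (ht hv))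

/-- The weight is invariant under maps that preserve and reflect adjacency. -/
theorem weight_image [DecidableEq W] {f : V → W} {U : Finset V} (hf : Set.InjOn f U)
    (hadj : ∀ u ∈ U, ∀ v ∈ U, H'.Adj (f u) (f v) ↔ H.Adj u v) :
    weight x H' (U.image f) = weight x H U := by
  classical
  have hinj : Set.InjOn (Finset.image f) (U.powerset : Set (Finset V)) :=
    Finset.image_injOn_powerset_of_injOn hf
  have hpow : ∀ {T}, T ∈ H.nests U → T ⊆ U.powerset := by
    intro T hT t ht
    rw [Finset.mem_powerset, ← (mem_nests.mp hT).2]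
    exact Finset.subset_biUnion_of_mem id ht
  have hnest : ∀ T ⊆ U.powerset, H'.IsNest (T.image (Finset.image f)) ↔ H.IsNest T := by
    intro T hT
    unfold IsNest
    simp only [Finset.forall_mem_image]
    have hTU : ∀ t ∈ T, t ⊆ U := fun t ht => Finset.mem_powerset.mp (hT ht)
    refine and_congr (forall₂_congr fun t ht => ?_)
      (forall₂_congr fun s hs => forall₂_congr fun t ht => ?_)
    · exact connected_induce_image_iff (hf.mono (hTU t ht))
        fun u hu v hv => hadj u (hTU t ht hu) v (hTU t ht hv)
    · exact compat_image_iff hf hadj (hTU s hs) (hTU t ht)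
  have hunion : ∀ T : Finset (Finset V),
      (T.image (Finset.image f)).biUnion id = (T.biUnion id).image f := by
    intro T
    rw [Finset.image_biUnion, Finset.biUnion_image]
    rfl
  rw [weight, weight]
  symm
  refine Finset.sum_bij (fun T _ => T.image (Finset.image f)) ?_ ?_ ?_ ?_
  · intro T hT
    rw [mem_nests, hnest T (hpow hT), hunion, (mem_nests.mp hT).2]
    exact ⟨(mem_nests.mp hT).1, rfl⟩
  · intro T hT T' hT' he
    have := Finset.image_injOn_powerset_of_injOn hinj
    exact this (Finset.mem_powerset.mpr (hpow hT)) (Finset.mem_powerset.mpr (hpow hT')) he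
  · intro T' hT'
    have hsub : T' ⊆ U.powerset.image (Finset.image f) := by
      intro t ht
      have : t ⊆ U.image f := by
        rw [← (mem_nests.mp hT').2]
        exact Finset.subset_biUnion_of_mem id ht
      obtain ⟨s, hs, rfl⟩ := Finset.subset_image_iff.mp this
      exact Finset.mem_image_of_mem _ (Finset.mem_powerset.mpr (by exact_mod_cast hs))
    obtain ⟨T, hT, rfl⟩ := Finset.subset_image_iff.mp hsub
    have hT : T ⊆ U.powerset := by exact_mod_cast hT
    refine ⟨T, ?_, rfl⟩
    rw [mem_nests, hnest T hT, hunion] at hT'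
    rw [mem_nests]
    refine ⟨hT'.1, hinj ?_ ?_ hT'.2⟩
    · rw [Finset.mem_coe, Finset.mem_powerset]
      exact Finset.biUnion_subset.mpr fun t ht => Finset.mem_powerset.mp (hT ht)
    · simp
  · intro T hT
    rw [Finset.card_image_of_injOn hf, Finset.card_image_of_injOn (hinj.mono
      (by exact_mod_cast hpow hT))]

end Weight

end SimpleGraph

/-! ### Sums over subsets of an interval -/

namespace Finset

variable {M : Type*} [AddCommGroup M]

theorem sum_powerset_image {α β : Type*} [DecidableEq α] [DecidableEq β] {f : α → β} {s : Finset α}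
    (hf : Set.InjOn f s) (F : Finset β → M) :
    ∑ V ∈ (s.image f).powerset, F V = ∑ V ∈ s.powerset, F (V.image f) := by
  rw [powerset_image, sum_image (image_injOn_powerset_of_injOn hf)]

theorem sum_powerset_eq_add_sum_ssubsets {α : Type*} [DecidableEq α] (s : Finset α)
    (F : Finset α → M) : ∑ U ∈ s.powerset, F U = F s + ∑ U ∈ s.ssubsets, F U :=
  (add_sum_erase _ _ (mem_powerset_self s)).symm

/-- Proper subsets of an initial segment, sorted by the largest missing element. -/
theorem sum_ssubsets_range_eq_sum_last (n : ℕ) (F : Finset ℕ → M) :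
    ∑ U ∈ (range n).ssubsets, F U =
      ∑ l ∈ range n, ∑ V ∈ (range l).powerset, F (V ∪ Ico (l + 1) n) := by
  induction n generalizing F with
  | zero => rfl
  | succ n ih =>
    have h1 := sum_powerset_eq_add_sum_ssubsets (range (n + 1)) F
    rw [range_add_one, sum_powerset_insert notMem_range_self,
      sum_powerset_eq_add_sum_ssubsets (range n) fun U => F (insert n U), ih, ← range_add_one] at h1
    have h2 : ∑ U ∈ (range (n + 1)).ssubsets, F U = ∑ U ∈ (range n).powerset, F U +
        ∑ l ∈ range n, ∑ V ∈ (range l).powerset, F (insert n (V ∪ Ico (l + 1) n)) := by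
      refine add_left_cancel (a := F (range (n + 1))) (h1.symm.trans ?_)
      abel
    rw [h2, sum_range_succ, add_comm]
    congr 1
    · refine sum_congr rfl fun l hl => sum_congr rfl fun V _ => ?_
      rw [mem_range] at hl
      rw [Nat.Ico_succ_right_eq_insert_Ico (by omega), union_insert]
    · refine sum_congr rfl fun V _ => ?_
      rw [Ico_self, union_empty]

/-- Proper subsets of an interval, sorted by the smallest missing element. -/
theorem sum_powerset_Ico_eq_sum_first (a m : ℕ) (F : Finset ℕ → M) :
    ∑ U ∈ (Ico a (a + m)).powerset, F U = F (Ico a (a + m)) +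
      ∑ k ∈ Ico a (a + m), ∑ V ∈ (Ico (k + 1) (a + m)).powerset, F (Ico a k ∪ V) := by
  induction m generalizing a F with
  | zero => simp
  | succ m ih =>
    have hI : Ico a (a + (m + 1)) = insert a (Ico (a + 1) (a + (m + 1))) :=
      (insert_Ico_add_one_left_eq_Ico (by omega)).symm
    have ha : a ∉ Ico (a + 1) (a + (m + 1)) := by simp
    have hm : a + (m + 1) = a + 1 + m := by ring
    rw [hI, sum_powerset_insert ha, sum_insert ha, Ico_self]
    simp only [empty_union]
    have key := ih (a + 1) fun U => F (insert a U)
    rw [← hm] at key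
    rw [key]
    have : ∑ k ∈ Ico (a + 1) (a + (m + 1)), ∑ V ∈ (Ico (k + 1) (a + (m + 1))).powerset,
        F (insert a (Ico (a + 1) k ∪ V)) = ∑ k ∈ Ico (a + 1) (a + (m + 1)),
        ∑ V ∈ (Ico (k + 1) (a + (m + 1))).powerset, F (Ico a k ∪ V) := by
      refine sum_congr rfl fun k hk => sum_congr rfl fun V _ => ?_
      rw [mem_Ico] at hk
      rw [← insert_union, insert_Ico_add_one_left_eq_Ico (by omega)]
    rw [this]
    abel

theorem sum_powerset_range_eq_sum_first (n : ℕ) (F : Finset ℕ → M) :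
    ∑ U ∈ (range n).powerset, F U = F (range n) +
      ∑ k ∈ range n, ∑ V ∈ (Ico (k + 1) n).powerset, F (range k ∪ V) := by
  have := sum_powerset_Ico_eq_sum_first 0 n F
  simpa only [zero_add, ← range_eq_Ico] using this

/-- The sum over all ordered pairs of disjoint subsets. -/
def pairSum {α : Type*} [DecidableEq α] (s : Finset α) (F : Finset α → Finset α → M) : M :=
  ∑ U ∈ s.powerset, ∑ V ∈ (s \ U).powerset, F U V

section pairSum

variable {α : Type*} [DecidableEq α]

theorem pairSum_congr {s : Finset α} {F G : Finset α → Finset α → M}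
    (h : ∀ U ⊆ s, ∀ V ⊆ s, Disjoint U V → F U V = G U V) : pairSum s F = pairSum s G :=
  sum_congr rfl fun U hU => sum_congr rfl fun V hV => by
    rw [mem_powerset] at hU hV
    exact h U hU V (hV.trans sdiff_subset) (disjoint_of_subset_right hV disjoint_sdiff)

theorem pairSum_empty (F : Finset α → Finset α → M) : pairSum ∅ F = F ∅ ∅ := by
  simp [pairSum]

theorem pairSum_zero (s : Finset α) : pairSum s (fun _ _ => (0 : M)) = 0 := by
  simp [pairSum]

theorem pairSum_add (s : Finset α) (F G : Finset α → Finset α → M) :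
    pairSum s (fun U V => F U V + G U V) = pairSum s F + pairSum s G := by
  simp [pairSum, sum_add_distrib]

theorem mul_pairSum {R : Type*} [CommRing R] (c : R) (s : Finset α)
    (F : Finset α → Finset α → R) : pairSum s (fun U V => c * F U V) = c * pairSum s F := by
  simp [pairSum, mul_sum]

/-- The new element lies in neither set, in the first, or in the second. -/
theorem pairSum_insert {s : Finset α} {a : α} (ha : a ∉ s) (F : Finset α → Finset α → M) :
    pairSum (insert a s) F = pairSum s F + pairSum s (fun U V => F (insert a U) V) +
      pairSum s (fun U V => F U (insert a V)) := by
  unfold pairSum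
  rw [sum_powerset_insert ha]
  have h1 : ∑ U ∈ s.powerset, ∑ V ∈ (insert a s \ U).powerset, F U V =
      ∑ U ∈ s.powerset, ∑ V ∈ (s \ U).powerset, F U V +
        ∑ U ∈ s.powerset, ∑ V ∈ (s \ U).powerset, F U (insert a V) := by
    rw [← sum_add_distrib]
    refine sum_congr rfl fun U hU => ?_
    rw [mem_powerset] at hU
    rw [insert_sdiff_of_notMem _ fun h => ha (hU h), sum_powerset_insert fun h =>
      ha (mem_sdiff.mp h).1]
  have h2 : ∑ U ∈ s.powerset, ∑ V ∈ (insert a s \ insert a U).powerset, F (insert a U) V =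
      ∑ U ∈ s.powerset, ∑ V ∈ (s \ U).powerset, F (insert a U) V := by
    refine sum_congr rfl fun U hU => ?_
    rw [insert_sdiff_insert, sdiff_insert_of_notMem ha]
  rw [h1, h2]
  abel

theorem pairSum_swap (s : Finset α) (F : Finset α → Finset α → M) :
    pairSum s F = pairSum s (fun U V => F V U) := by
  induction s using Finset.induction_on generalizing F with
  | empty => rw [pairSum_empty, pairSum_empty]
  | insert a s ha ih =>
    rw [pairSum_insert ha, pairSum_insert ha, ih F, ih fun U V => F (insert a U) V,
      ih fun U V => F U (insert a V)]
    abel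

theorem pairSum_image {β : Type*} [DecidableEq β] {f : α → β} {s : Finset α} (hf : Set.InjOn f s)
    (F : Finset β → Finset β → M) :
    pairSum (s.image f) F = pairSum s (fun U V => F (U.image f) (V.image f)) := by
  unfold pairSum
  rw [sum_powerset_image hf]
  refine sum_congr rfl fun U hU => ?_
  rw [mem_powerset] at hU
  rw [← image_sdiff_of_injOn hf hU, sum_powerset_image (hf.mono (by exact_mod_cast sdiff_subset))]

end pairSum

/-- Pairs of disjoint sets the second of which contains the last element, sorted by its last
maximal run. -/
theorem pairSum_range_insert_right (n : ℕ) (F : Finset ℕ → Finset ℕ → M) :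
    pairSum (range n) (fun U V => F U (insert n V)) = ∑ k ∈ range (n + 1),
      pairSum (range k) (fun U V => if k - 1 ∈ V then 0 else F U (V ∪ Ico k (n + 1))) := by
  induction n generalizing F with
  | zero => simp [pairSum_empty]
  | succ n ih =>
    rw [sum_range_succ]
    have h1 : pairSum (range (n + 1)) (fun U V => F U (insert (n + 1) V)) =
        pairSum (range (n + 1)) (fun U V => if n ∈ V then F U (insert (n + 1) V) else 0) +
        pairSum (range (n + 1)) (fun U V => if n ∈ V then 0 else F U (insert (n + 1) V)) := by
      rw [← pairSum_add]
      refine pairSum_congr fun U _ V _ _ => ?_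
      split_ifs <;> simp
    rw [h1]
    congr 1
    · rw [range_add_one, pairSum_insert notMem_range_self]
      have e1 : pairSum (range n) (fun U V => if n ∈ V then F U (insert (n + 1) V) else 0) = 0 := by
        exact (pairSum_congr fun U _ V hV _ => if_neg fun h => notMem_range_self (hV h)).trans
          (pairSum_zero _)
      have e2 : pairSum (range n)
          (fun U V => if n ∈ V then F (insert n U) (insert (n + 1) V) else 0) = 0 := by
        exact (pairSum_congr fun U _ V hV _ => if_neg fun h => notMem_range_self (hV h)).trans
          (pairSum_zero _)
      rw [e1, e2, zero_add, zero_add, ← range_add_one]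
      simp only [mem_insert_self, if_true]
      rw [ih fun U V => F U (insert (n + 1) V)]
      refine sum_congr rfl fun k hk => pairSum_congr fun U _ V _ _ => ?_
      rw [mem_range] at hk
      rw [Nat.Ico_succ_right_eq_insert_Ico (b := n + 1) (by omega), union_insert]
    · refine pairSum_congr fun U _ V _ _ => ?_
      rw [Nat.add_sub_cancel, Nat.Ico_succ_singleton, union_comm, insert_eq]

theorem pairSum_range_insert_left (n : ℕ) (F : Finset ℕ → Finset ℕ → M) :
    pairSum (range n) (fun U V => F (insert n U) V) = ∑ k ∈ range (n + 1),
      pairSum (range k) (fun U V => if k - 1 ∈ U then 0 else F (U ∪ Ico k (n + 1)) V) := by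
  rw [pairSum_swap, pairSum_range_insert_right n fun U V => F V U]
  exact sum_congr rfl fun k _ => pairSum_swap _ _

end Finset

/-! ### Paths and cycles on the natural numbers -/

namespace SimpleGraph

open Finset

/-- The infinite path on the natural numbers. -/
def natPath : SimpleGraph ℕ where
  Adj a b := a + 1 = b ∨ b + 1 = a
  symm := ⟨fun _ _ h => h.symm⟩
  loopless := ⟨fun a h => by omega⟩

/-- The cycle on the natural numbers less than `N`. -/
def natCycle (N : ℕ) : SimpleGraph ℕ where
  Adj a b := a ≠ b ∧ (a + 1 = b ∨ b + 1 = a ∨ (a = 0 ∧ b + 1 = N) ∨ (b = 0 ∧ a + 1 = N))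
  symm := ⟨fun _ _ h => by omega⟩
  loopless := ⟨fun a h => by omega⟩

theorem natPath_adj {a b : ℕ} : natPath.Adj a b ↔ a + 1 = b ∨ b + 1 = a := Iff.rfl

theorem natCycle_adj {N a b : ℕ} : (natCycle N).Adj a b ↔
    a ≠ b ∧ (a + 1 = b ∨ b + 1 = a ∨ (a = 0 ∧ b + 1 = N) ∨ (b = 0 ∧ a + 1 = N)) := Iff.rfl

theorem connected_induce_range {H : SimpleGraph ℕ} (hH : ∀ i, H.Adj i (i + 1)) (n : ℕ) :
    (H.induce ((range (n + 1) : Finset ℕ) : Set ℕ)).Connected := by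
  rw [connected_iff_exists_forall_reachable]
  refine ⟨⟨0, by simp⟩, ?_⟩
  rintro ⟨i, hi⟩
  induction i with
  | zero => rfl
  | succ i ih =>
    have hi' : i + 1 < n + 1 := by simpa using hi
    have hmem : i ∈ ((range (n + 1) : Finset ℕ) : Set ℕ) := by simp; omega
    exact (ih hmem).trans (Adj.reachable (G := H.induce _) (u := ⟨i, hmem⟩) (hH i))

theorem natPath_adj_succ (i : ℕ) : natPath.Adj i (i + 1) := Or.inl rfl

theorem natCycle_adj_succ (N i : ℕ) : (natCycle N).Adj i (i + 1) := ⟨by omega, Or.inl rfl⟩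

section Weights

variable {R : Type*} [CommRing R] (x : R)

/-- The weight of a path with `s` vertices. -/
noncomputable def pathWeight (s : ℕ) : R := weight x natPath (range s)

/-- The weight of a cycle with `N` vertices. -/
noncomputable def cycleWeight (N : ℕ) : R := weight x (natCycle N) (range N)

/-- The sum of the weights of all subsets of a path with `n` vertices. -/
noncomputable def pathSum (n : ℕ) : R :=
  ∑ U ∈ (range n).powerset, x ^ (n - U.card) * weight x natPath U

theorem pathWeight_zero : pathWeight x 0 = 1 := weight_empty x

theorem weight_image_add (H : SimpleGraph ℕ) (k : ℕ) (U : Finset ℕ)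
    (hH : ∀ a b, H.Adj (a + k) (b + k) ↔ natPath.Adj a b) :
    weight x H (U.image (· + k)) = weight x natPath U :=
  weight_image x (add_left_injective k).injOn fun _ _ _ _ => hH _ _

theorem natPath_adj_add (k a b : ℕ) : natPath.Adj (a + k) (b + k) ↔ natPath.Adj a b := by
  simp only [natPath_adj]; omega

theorem image_add_Ico (a b k : ℕ) : (Ico a b).image (· + k) = Ico (a + k) (b + k) :=
  image_add_right_Ico a b k

theorem weight_natPath_Ico {k n : ℕ} (h : k ≤ n) :
    weight x natPath (Ico k n) = pathWeight x (n - k) := by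
  rw [pathWeight, ← weight_image_add x natPath k (range (n - k)) (natPath_adj_add k), range_eq_Ico,
    image_add_Ico, zero_add, Nat.sub_add_cancel h]

/-- The missing vertex `k - 1` is the gap between `V` and the run. For `k = 0` the set `V` is empty
and nothing is required. -/
theorem separated_natPath_Ico {V : Finset ℕ} {k n : ℕ} (hV : V ⊆ range k) (hk : k - 1 ∉ V) :
    natPath.Separated V (Ico k n) := by
  refine ⟨Finset.disjoint_left.mpr fun a ha hb => ?_, fun a ha b hb hab => ?_⟩
  · have := hV ha
    simp only [mem_range, mem_Ico] at this hb
    omega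
  · have h1 := hV ha
    have h2 : a ≠ k - 1 := fun h => hk (h ▸ ha)
    simp only [mem_range, mem_Ico, natPath_adj] at h1 hb hab
    omega

theorem card_of_subset_range {V : Finset ℕ} {n : ℕ} (h : V ⊆ range n) : V.card ≤ n := by
  simpa using card_le_card h

theorem pathWeight_succ (n : ℕ) : pathWeight x (n + 1) =
    ∑ U ∈ (range (n + 1)).ssubsets, x ^ (n - U.card) * weight x natPath U := by
  rw [pathWeight, weight_of_connected x (connected_induce_range natPath_adj_succ n)]
  simp

theorem cycleWeight_succ (n : ℕ) : cycleWeight x (n + 1) =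
    ∑ U ∈ (range (n + 1)).ssubsets, x ^ (n - U.card) * weight x (natCycle (n + 1)) U := by
  rw [cycleWeight, weight_of_connected x (connected_induce_range (natCycle_adj_succ _) n)]
  simp

theorem pathSum_zero : pathSum x 0 = 1 := by
  simp [pathSum, weight_empty]

/-- The full path contributes its weight; the proper subsets contribute `x` times the recursion for
the same weight. -/
theorem pathSum_succ (n : ℕ) : pathSum x (n + 1) = (1 + x) * pathWeight x (n + 1) := by
  rw [pathSum, sum_powerset_eq_add_sum_ssubsets, add_mul, one_mul]
  congr 1
  · simp [pathWeight]
  · rw [pathWeight_succ, mul_sum]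
    refine sum_congr rfl fun U hU => ?_
    have := card_lt_card (mem_ssubsets.mp hU)
    rw [card_range] at this
    rw [← mul_assoc, ← pow_succ']
    congr 2
    omega

/-- The largest missing vertex `l` separates an arbitrary subset of the first `l` vertices from a
full final path, and itself accounts for the factor `x`. Compared with `pathSum_succ`, this yields
the quadratic equation for associahedra. -/
theorem pathSum_eq (n : ℕ) : pathSum x n = pathWeight x n +
    ∑ l ∈ range n, x * (pathSum x l * pathWeight x (n - 1 - l)) := by
  rw [pathSum, sum_powerset_eq_add_sum_ssubsets, sum_ssubsets_range_eq_sum_last]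
  congr 1
  · simp [pathWeight]
  · refine sum_congr rfl fun l hl => ?_
    rw [mem_range] at hl
    rw [pathSum, sum_mul, mul_sum]
    refine sum_congr rfl fun V hV => ?_
    rw [mem_powerset] at hV
    have hc := card_of_subset_range hV
    have hsep : natPath.Separated V (Ico (l + 1) n) :=
      separated_natPath_Ico (hV.trans (range_subset_range.mpr (Nat.le_succ l)))
        fun h => by simpa using hV h
    rw [weight_union x hsep, weight_natPath_Ico x (by omega), card_union_of_disjoint hsep.1,
      Nat.card_Ico, show n - (V.card + (n - (l + 1))) = (l - V.card) + 1 by omega, pow_succ,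
      show n - (l + 1) = n - 1 - l by omega]
    ring

/-- The only edge by which the cycle differs from the path ends at `0`. -/
theorem weight_natCycle_of_notMem_zero {N : ℕ} {V : Finset ℕ} (h0 : 0 ∉ V) :
    weight x (natCycle N) V = weight x natPath V := by
  have := weight_image (H := natPath) (H' := natCycle N) x (f := id) (U := V) Function.injective_id.injOn
    fun u hu v hv => by
      have h1 : u ≠ 0 := fun h => h0 (h ▸ hu)
      have h2 : v ≠ 0 := fun h => h0 (h ▸ hv)
      simp only [id, natPath_adj, natCycle_adj]
      omega
  rwa [image_id] at this

theorem weight_natCycle_arc {N k l : ℕ} (hkl : k ≤ l) (hl : l < N) :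
    weight x (natCycle N) (range k ∪ Ico (l + 1) N) = pathWeight x (k + (N - 1 - l)) := by
  -- Rotation that starts the arc just after the missing vertex `l` and runs through `0`.
  set f : ℕ → ℕ := fun i => if i + (l + 1) < N then i + (l + 1) else i + (l + 1) - N with hf
  have himg : (range (k + (N - 1 - l))).image f = range k ∪ Ico (l + 1) N := by
    ext a
    simp only [mem_image, mem_union, mem_range, mem_Ico, hf]
    constructor
    · rintro ⟨i, hi, rfl⟩
      split_ifs <;> omega
    · rintro (ha | ha)
      · exact ⟨a + (N - 1 - l), by omega, by rw [if_neg (by omega)]; omega⟩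
      · exact ⟨a - (l + 1), by omega, by rw [if_pos (by omega)]; omega⟩
  rw [← himg, pathWeight]
  refine weight_image x ?_ ?_
  · intro a ha b hb hab
    rw [mem_coe, mem_range] at ha hb
    simp only [hf] at hab
    split_ifs at hab <;> omega
  · intro a ha b hb
    simp only [mem_range] at ha hb
    simp only [hf, natPath_adj, natCycle_adj]
    split_ifs <;> constructor <;> intro h <;> (try rcases h.2 with h' | h' | h' | h') <;> 
      first | omega | exact h'.1.elim

theorem separated_natCycle_arc {N k l : ℕ} {V : Finset ℕ} (hl : l < N) (hV : V ⊆ Ico (k + 1) l) :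
    (natCycle N).Separated (range k ∪ Ico (l + 1) N) V := by
  refine ⟨Finset.disjoint_left.mpr fun a ha hb => ?_, fun a ha b hb hab => ?_⟩
  · have := hV hb
    simp only [mem_union, mem_range, mem_Ico] at this ha
    omega
  · have := hV hb
    simp only [mem_union, mem_range, mem_Ico, natCycle_adj] at this ha hab
    omega

theorem card_arc {N k l : ℕ} (hkl : k ≤ l) :
    (range k ∪ Ico (l + 1) N).card = k + (N - 1 - l) := by
  rw [card_union_of_disjoint, card_range, Nat.card_Ico]
  · omega
  · exact Finset.disjoint_left.mpr fun a ha hb => by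
      simp only [mem_range, mem_Ico] at ha hb
      omega

/-- Proper subsets of a cycle, sorted by the smallest and the largest missing element. -/
theorem sum_ssubsets_range_eq_sum_arcs {M : Type*} [AddCommGroup M] (N : ℕ) (F : Finset ℕ → M) :
    ∑ U ∈ (range N).ssubsets, F U = ∑ l ∈ range N, (F (range l ∪ Ico (l + 1) N) +
      ∑ k ∈ range l, ∑ V ∈ (Ico (k + 1) l).powerset, F ((range k ∪ Ico (l + 1) N) ∪ V)) := by
  rw [sum_ssubsets_range_eq_sum_last]
  refine sum_congr rfl fun l _ => ?_
  rw [sum_powerset_range_eq_sum_first l fun V => F (V ∪ Ico (l + 1) N)]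
  refine congrArg₂ _ rfl (sum_congr rfl fun k _ => sum_congr rfl fun V _ => ?_)
  rw [union_right_comm]

/-- The first term collects the subsets missing exactly one vertex. Otherwise the first and last
missing vertices `k < l` cut off an arc through the wrap-around and leave a free subset strictly
between them. Two missing vertices give only one factor `x`, since the exponent starts at `n`, not
`n + 1`. -/
theorem cycleWeight_eq (n : ℕ) : cycleWeight x (n + 1) = (n + 1) * pathWeight x n +
    ∑ l ∈ range (n + 1), ∑ k ∈ range l, x * (pathWeight x (k + (n - l)) * pathSum x (l - 1 - k)) := by
  rw [cycleWeight_succ, sum_ssubsets_range_eq_sum_arcs, sum_add_distrib]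
  congr 1
  · rw [show ((n : R) + 1) * pathWeight x n = ∑ _l ∈ range (n + 1), pathWeight x n by simp]
    refine sum_congr rfl fun l hl => ?_
    rw [mem_range] at hl
    rw [card_arc le_rfl, weight_natCycle_arc x le_rfl hl,
      show l + (n + 1 - 1 - l) = n by omega, Nat.sub_self, pow_zero, one_mul]
  · refine sum_congr rfl fun l hl => sum_congr rfl fun k hk => ?_
    rw [mem_range] at hl hk
    have hI : Ico (k + 1) l = (range (l - 1 - k)).image (· + (k + 1)) := by
      rw [range_eq_Ico, image_add_Ico]
      congr 1 <;> omega
    have hinj : Set.InjOn (· + (k + 1)) ((range (l - 1 - k) : Finset ℕ) : Set ℕ) :=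
      (add_left_injective (k + 1)).injOn
    rw [hI, sum_powerset_image hinj, pathSum, mul_sum, mul_sum]
    refine sum_congr rfl fun V hV => ?_
    have hVI : V.image (· + (k + 1)) ⊆ Ico (k + 1) l := by
      rw [hI]; exact image_subset_image (mem_powerset.mp hV)
    have hc := card_of_subset_range (mem_powerset.mp hV)
    have hsep := separated_natCycle_arc (N := n + 1) hl hVI
    rw [weight_union x hsep, card_union_of_disjoint hsep.1, card_arc hk.le,
      weight_natCycle_arc x hk.le hl, weight_natCycle_of_notMem_zero x (fun h => by simpa using hVI h),
      weight_image_add x natPath (k + 1) _ (natPath_adj_add _),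
      card_image_of_injective _ (add_left_injective _),
      show n - (k + (n + 1 - 1 - l) + V.card) = (l - 1 - k - V.card) + 1 by omega, pow_succ,
      show n + 1 - 1 - l = n - l by omega]
    ring

/-! ### Transfer recursion for pairs of disjoint subsets of a path. -/

/-- The contribution of a pair of disjoint subsets of a path with `n` vertices. -/
noncomputable def pairWeight (n : ℕ) (U V : Finset ℕ) : R :=
  x ^ (n - U.card - V.card) * (weight x natPath U * weight x natPath V)

/-- The sum over all pairs of disjoint subsets of a path, where the first set may be required not to
contain the first vertex. -/
noncomputable def doublePathSum (b : Bool) (n : ℕ) : R :=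
  pairSum (range n) fun U V => if b = true → 0 ∉ U then pairWeight x n U V else 0

/-- As `doublePathSum`, but the first set may not contain the last vertex. -/
noncomputable def doublePathSumLeft (b : Bool) (n : ℕ) : R :=
  pairSum (range n) fun U V =>
    if n - 1 ∈ U then 0 else if b = true → 0 ∉ U then pairWeight x n U V else 0

/-- As `doublePathSum`, but the second set may not contain the last vertex. -/
noncomputable def doublePathSumRight (b : Bool) (n : ℕ) : R :=
  pairSum (range n) fun U V =>
    if n - 1 ∈ V then 0 else if b = true → 0 ∉ U then pairWeight x n U V else 0

theorem doublePathSum_zero (b : Bool) : doublePathSum x b 0 = 1 := by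
  simp [doublePathSum, pairSum_empty, pairWeight, weight_empty]

/-- For `n = 0` the truncated index `n - 1` is `0`, which is not in the empty set, so the end
condition does not exclude the empty pair. -/
theorem doublePathSumLeft_zero (b : Bool) : doublePathSumLeft x b 0 = 1 := by
  simp [doublePathSumLeft, pairSum_empty, pairWeight, weight_empty]

theorem doublePathSumRight_zero (b : Bool) : doublePathSumRight x b 0 = 1 := by
  simp [doublePathSumRight, pairSum_empty, pairWeight, weight_empty]

theorem card_add_card_le {U V s : Finset ℕ} (hU : U ⊆ s) (hV : V ⊆ s) (h : Disjoint U V) :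
    U.card + V.card ≤ s.card := by
  rw [← card_union_of_disjoint h]
  exact card_le_card (union_subset hU hV)

theorem pairSum_range_succ_pairWeight (b : Bool) (n : ℕ) :
    (pairSum (range n) fun U V => if b = true → 0 ∉ U then pairWeight x (n + 1) U V else 0) =
      x * doublePathSum x b n := by
  rw [doublePathSum, ← mul_pairSum]
  refine pairSum_congr fun U hU V hV hd => ?_
  have := card_add_card_le hU hV hd
  rw [card_range] at this
  rw [mul_ite, mul_zero, pairWeight, pairWeight,
    show n + 1 - U.card - V.card = n - U.card - V.card + 1 by omega, pow_succ', mul_assoc]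

/-- The final run `k, ..., n` of the second set is a full path separated from the rest of that set,
so its weight factors out; what remains is a pair on `k` vertices whose second set avoids the last
one. -/
theorem pairSum_lastRun_right (b : Bool) (n : ℕ) :
    (pairSum (range n) fun U V =>
      if b = true → 0 ∉ U then pairWeight x (n + 1) U (insert n V) else 0) =
      ∑ k ∈ range (n + 1), doublePathSumRight x b k * pathWeight x (n + 1 - k) := by
  rw [pairSum_range_insert_right n fun U V =>
    if b = true → 0 ∉ U then pairWeight x (n + 1) U V else 0]
  refine sum_congr rfl fun k hk => ?_
  rw [mem_range] at hk
  rw [doublePathSumRight, mul_comm, ← mul_pairSum]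
  refine pairSum_congr fun U hU V hV hd => ?_
  split_ifs with h1 h2
  · rw [mul_zero]
  · have hsep := separated_natPath_Ico (n := n + 1) hV h1
    have := card_add_card_le hU hV hd
    rw [card_range] at this
    rw [pairWeight, pairWeight, weight_union x hsep, card_union_of_disjoint hsep.1, Nat.card_Ico,
      weight_natPath_Ico x hk.le,
      show n + 1 - U.card - (V.card + (n + 1 - k)) = k - U.card - V.card by omega]
    ring
  · rw [mul_zero]

theorem pairSum_lastRun_left (b : Bool) (n : ℕ) :
    (pairSum (range n) fun U V =>
      if b = true → 0 ∉ insert n U then pairWeight x (n + 1) (insert n U) V else 0) =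
      ∑ k ∈ range (n + 1), if b = true ∧ k = 0 then 0 else
        doublePathSumLeft x b k * pathWeight x (n + 1 - k) := by
  rw [pairSum_range_insert_left n fun U V =>
    if b = true → 0 ∉ U then pairWeight x (n + 1) U V else 0]
  refine sum_congr rfl fun k hk => ?_
  rw [mem_range] at hk
  split_ifs with hbk
  -- A run starting at `k = 0` would put the forbidden vertex `0` in the first set.
  · obtain ⟨hb, rfl⟩ := hbk
    rw [range_zero, pairSum_empty, if_neg (notMem_empty _), if_neg]
    intro h
    exact h hb (by simp)
  rw [doublePathSumLeft, mul_comm, ← mul_pairSum]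
  refine pairSum_congr fun U hU V hV hd => ?_
  have hiff : (b = true → 0 ∉ U ∪ Ico k (n + 1)) ↔ (b = true → 0 ∉ U) := by
    refine forall_congr' fun hb => ?_
    have : k ≠ 0 := fun h => hbk ⟨hb, h⟩
    rw [mem_union, mem_Ico]
    simp [this]
  split_ifs with h1 h2 h3 h3
  · rw [mul_zero]
  · have hsep := separated_natPath_Ico (n := n + 1) hU h1
    have := card_add_card_le hU hV hd
    rw [card_range] at this
    rw [pairWeight, pairWeight, weight_union x hsep, card_union_of_disjoint hsep.1, Nat.card_Ico,
      weight_natPath_Ico x hk.le,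
      show n + 1 - (U.card + (n + 1 - k)) - V.card = k - U.card - V.card by omega]
    ring
  · exact absurd (hiff.mp h2) h3
  · exact absurd (hiff.mpr h3) h2
  · rw [mul_zero]

/-- The three terms are the cases in which the last vertex lies in neither set, in the first, or in
the second. -/
theorem doublePathSum_succ (b : Bool) (n : ℕ) : doublePathSum x b (n + 1) =
    x * doublePathSum x b n +
      (∑ k ∈ range (n + 1), if b = true ∧ k = 0 then 0 else
        doublePathSumLeft x b k * pathWeight x (n + 1 - k)) +
      ∑ k ∈ range (n + 1), doublePathSumRight x b k * pathWeight x (n + 1 - k) := by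
  rw [doublePathSum, range_add_one, pairSum_insert notMem_range_self, ← range_add_one,
    pairSum_range_succ_pairWeight, pairSum_lastRun_right, pairSum_lastRun_left]

theorem doublePathSumLeft_succ (b : Bool) (n : ℕ) : doublePathSumLeft x b (n + 1) =
    x * doublePathSum x b n +
      ∑ k ∈ range (n + 1), doublePathSumRight x b k * pathWeight x (n + 1 - k) := by
  rw [doublePathSumLeft, range_add_one, pairSum_insert notMem_range_self, ← range_add_one,
    ← pairSum_range_succ_pairWeight, ← pairSum_lastRun_right, Nat.add_sub_cancel]
  simp only [mem_insert_self, if_true, pairSum_zero, add_zero]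
  congr 1 <;>
  exact pairSum_congr fun U hU V hV _ => if_neg fun h => notMem_range_self (hU h)

theorem doublePathSumRight_succ (b : Bool) (n : ℕ) : doublePathSumRight x b (n + 1) =
    x * doublePathSum x b n +
      ∑ k ∈ range (n + 1), if b = true ∧ k = 0 then 0 else
        doublePathSumLeft x b k * pathWeight x (n + 1 - k) := by
  rw [doublePathSumRight, range_add_one, pairSum_insert notMem_range_self, ← range_add_one,
    ← pairSum_range_succ_pairWeight, ← pairSum_lastRun_left, Nat.add_sub_cancel]
  simp only [mem_insert_self, if_true, pairSum_zero, add_zero]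
  congr 1 <;>
  exact pairSum_congr fun U hU V hV _ => if_neg fun h => notMem_range_self (hV h)

/-- The cis double path sum: the first set avoids both ends. -/
theorem doublePathSumLeft_true_eq (n : ℕ) : doublePathSumLeft x true n =
    ∑ U ∈ (Ico 1 (n - 1)).powerset, ∑ V ∈ (range n \ U).powerset, pairWeight x n U V := by
  have : (Ico 1 (n - 1)).powerset = (range n).powerset.filter fun U => n - 1 ∉ U ∧ 0 ∉ U := by
    ext U
    simp only [mem_powerset, mem_filter]
    constructor
    · intro h
      refine ⟨fun a ha => ?_, fun ha => ?_, fun ha => ?_⟩ <;> have := h ha <;>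
        simp only [mem_Ico, mem_range] at this ⊢ <;> omega
    · rintro ⟨h, h1, h2⟩ a ha
      have h3 := h ha
      have h4 : a ≠ n - 1 := fun he => h1 (he ▸ ha)
      have h5 : a ≠ 0 := fun he => h2 (he ▸ ha)
      simp only [mem_Ico, mem_range] at h3 ⊢
      omega
  rw [this, sum_filter, doublePathSumLeft, pairSum]
  refine sum_congr rfl fun U _ => ?_
  by_cases h1 : n - 1 ∈ U
  · simp [h1]
  by_cases h2 : 0 ∈ U
  · simp [h2]
  · simp [h1, h2]

/-! ### Pairs of disjoint subsets of a cycle. -/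

/-- The sum over pairs of disjoint subsets of a cycle with `n` vertices. -/
noncomputable def doubleCycleSum (n : ℕ) : R :=
  pairSum (range n) fun U V =>
    x ^ (n - U.card - V.card) * (weight x (natCycle n) U * weight x (natCycle n) V)

/-- The vertices outside the arc form the path `k, ..., l`. The first set misses both of its ends,
while the second set is restricted only by disjointness; shifting by `k` gives the cis double path.
Since `0 < k`, the vertex `0` lies in the arc, so all other sets see only path edges. -/
theorem sum_arc_doublePath {N k l : ℕ} (hk : 0 < k) (hkl : k ≤ l) (hl : l < N) :
    ∑ U ∈ (Ico (k + 1) l).powerset,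
      ∑ V ∈ (range N \ ((range k ∪ Ico (l + 1) N) ∪ U)).powerset,
        x ^ (N - ((range k ∪ Ico (l + 1) N) ∪ U).card - V.card) *
          (weight x (natCycle N) ((range k ∪ Ico (l + 1) N) ∪ U) * weight x (natCycle N) V) =
      pathWeight x (k + (N - 1 - l)) * doublePathSumLeft x true (l + 1 - k) := by
  have hI : Ico (k + 1) l = (Ico 1 (l + 1 - k - 1)).image (· + k) := by
    rw [image_add_Ico]; congr 1 <;> omega
  have hinj : ∀ s : Set ℕ, Set.InjOn (· + k) s := fun s => (add_left_injective k).injOn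
  rw [hI, sum_powerset_image (hinj _), doublePathSumLeft_true_eq, mul_sum]
  refine sum_congr rfl fun U hU => ?_
  have hUI : U.image (· + k) ⊆ Ico (k + 1) l := by
    rw [hI]; exact image_subset_image (mem_powerset.mp hU)
  have hUr : U ⊆ range (l + 1 - k) := fun a ha => by
    have := mem_powerset.mp hU ha
    simp only [mem_Ico, mem_range] at this ⊢
    omega
  have hsep := separated_natCycle_arc (N := N) hl hUI
  have hD : range N \ ((range k ∪ Ico (l + 1) N) ∪ U.image (· + k)) =
      (range (l + 1 - k) \ U).image (· + k) := by
    rw [image_sdiff _ _ (add_left_injective k), range_eq_Ico (l + 1 - k), image_add_Ico]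
    ext a
    simp only [mem_sdiff, mem_union, mem_range, mem_Ico, not_or]
    rw [← and_assoc]
    exact and_congr_left fun _ => by omega
  rw [hD, sum_powerset_image (hinj _), mul_sum]
  refine sum_congr rfl fun V hV => ?_
  have hVs := mem_powerset.mp hV
  have hc := card_add_card_le hUr (hVs.trans sdiff_subset)
    (disjoint_of_subset_right hVs disjoint_sdiff)
  rw [card_range] at hc
  rw [weight_union x hsep, card_union_of_disjoint hsep.1, card_arc hkl,
    weight_natCycle_arc x hkl hl, weight_natCycle_of_notMem_zero x (fun h => by simpa using hUI h),
    weight_natCycle_of_notMem_zero (V := V.image _) x (fun h => by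
      obtain ⟨a, -, ha⟩ := mem_image.mp h
      omega),
    weight_image_add x natPath k _ (natPath_adj_add _),
    weight_image_add x natPath k _ (natPath_adj_add _),
    card_image_of_injective _ (add_left_injective _), card_image_of_injective _ (add_left_injective _),
    pairWeight, show N - (k + (N - 1 - l) + U.card) - V.card = l + 1 - k - U.card - V.card by omega]
  ring

theorem doubleCycleSum_succ (n : ℕ) : doubleCycleSum x (n + 1) =
    x * doublePathSum x false n + 2 * cycleWeight x (n + 1) +
      2 * ∑ l ∈ range (n + 1), ∑ k ∈ range l,
        pathWeight x (k + 1 + (n - l)) * doublePathSumLeft x true (l - k) := by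
  set F : Finset ℕ → Finset ℕ → R := fun U V => x ^ (n + 1 - U.card - V.card) *
    (weight x (natCycle (n + 1)) U * weight x (natCycle (n + 1)) V) with hF
  have hsplit : doubleCycleSum x (n + 1) =
      pairSum (range (n + 1)) (fun U V => if 0 ∈ U ∨ 0 ∈ V then 0 else F U V) +
      pairSum (range (n + 1)) (fun U V => if 0 ∈ U then F U V else 0) +
      pairSum (range (n + 1)) (fun U V => if 0 ∈ V then F U V else 0) := by
    rw [← pairSum_add, ← pairSum_add, doubleCycleSum]
    refine pairSum_congr fun U _ V _ hd => ?_
    by_cases hU : 0 ∈ U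
    · have hV : 0 ∉ V := Finset.disjoint_left.mp hd hU
      simp [hU, hV, hF]
    · by_cases hV : 0 ∈ V <;> simp [hU, hV, hF]
  have hswap : pairSum (range (n + 1)) (fun U V => if 0 ∈ V then F U V else 0) =
      pairSum (range (n + 1)) (fun U V => if 0 ∈ U then F U V else 0) := by
    rw [pairSum_swap]
    refine pairSum_congr fun U _ V _ _ => ?_
    simp only [hF]
    rw [Nat.sub_right_comm, mul_comm (weight x (natCycle (n + 1)) V)]
  have hneither : pairSum (range (n + 1)) (fun U V => if 0 ∈ U ∨ 0 ∈ V then 0 else F U V) =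
      x * doublePathSum x false n := by
    have hr : range (n + 1) = insert 0 ((range n).image (· + 1)) := by
      rw [range_eq_Ico n, image_add_Ico, range_eq_Ico,
        ← insert_Ico_add_one_left_eq_Ico (Nat.succ_pos n)]
    rw [hr, pairSum_insert (by simp), pairSum_image (add_left_injective 1).injOn]
    simp only [mem_insert_self, true_or, or_true, if_true, pairSum_zero, add_zero]
    rw [← pairSum_range_succ_pairWeight]
    refine pairSum_congr fun U _ V _ _ => ?_
    have h0 : ∀ W : Finset ℕ, 0 ∉ W.image (· + 1) := fun W h => by
      obtain ⟨a, -, ha⟩ := mem_image.mp h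
      omega
    rw [if_neg (by simp), if_pos (by simp)]
    simp only [hF, pairWeight]
    rw [weight_natCycle_of_notMem_zero x (h0 U), weight_natCycle_of_notMem_zero x (h0 V),
      weight_image_add x natPath 1 _ (natPath_adj_add _),
      weight_image_add x natPath 1 _ (natPath_adj_add _),
      card_image_of_injective _ (add_left_injective _),
      card_image_of_injective _ (add_left_injective _)]
  have hpos : pairSum (range (n + 1)) (fun U V => if 0 ∈ U then F U V else 0) =
      cycleWeight x (n + 1) + ∑ l ∈ range (n + 1), ∑ k ∈ range l,
        pathWeight x (k + 1 + (n - l)) * doublePathSumLeft x true (l - k) := by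
    rw [pairSum, sum_powerset_eq_add_sum_ssubsets, sum_ssubsets_range_eq_sum_arcs]
    congr 1
    · simp [hF, cycleWeight, weight_empty]
    · refine sum_congr rfl fun l hl => ?_
      rw [mem_range] at hl
      -- `H k` collects the first sets with smallest missing vertex `k` and largest `l`. The case `k
      -- = l` of one missing vertex is absorbed as `H l`, and `H 0` vanishes because `0` must belong
      -- to the set.
      set H : ℕ → R := fun k => ∑ U ∈ (Ico (k + 1) l).powerset,
        ∑ V ∈ (range (n + 1) \ ((range k ∪ Ico (l + 1) (n + 1)) ∪ U)).powerset,
          if 0 ∈ (range k ∪ Ico (l + 1) (n + 1)) ∪ U then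
            F ((range k ∪ Ico (l + 1) (n + 1)) ∪ U) V else 0 with hH
      have hlast : ∑ V ∈ (range (n + 1) \ (range l ∪ Ico (l + 1) (n + 1))).powerset,
          (if 0 ∈ range l ∪ Ico (l + 1) (n + 1) then
            F (range l ∪ Ico (l + 1) (n + 1)) V else 0) = H l := by
        simp only [hH]
        rw [Ico_eq_empty (by omega : ¬ l + 1 < l), powerset_empty, sum_singleton, union_empty]
      have hzero : H 0 = 0 := by
        refine sum_eq_zero fun U hU => sum_eq_zero fun V _ => if_neg fun h => ?_
        simp only [range_zero, empty_union, mem_union, mem_Ico] at h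
        rcases h with h | h
        · omega
        · simpa using mem_powerset.mp hU h
      rw [hlast, add_comm, ← sum_range_succ H l, sum_range_succ' H l, hzero, add_zero]
      refine sum_congr rfl fun k hk => ?_
      rw [mem_range] at hk
      have := sum_arc_doublePath x (N := n + 1) (k := k + 1) (l := l) (by omega) (by omega) hl
      rw [show l + 1 - (k + 1) = l - k by omega, show n + 1 - 1 - l = n - l by omega] at this
      rw [← this]
      refine sum_congr rfl fun U _ => sum_congr rfl fun V _ => if_pos ?_
      simp
  rw [hsplit, hswap, hneither, hpos]
  ring

end Weights

end SimpleGraph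

/-! ### Face numbers of graph associahedra as sums over the faces of the complex -/

namespace DeltaGraph

open Finset SimpleGraph

variable {V : Type}

open Classical in
/-- The faces of the simplicial complex. -/
noncomputable def faces [Fintype V] (G : DeltaGraph V) : Finset (Finset V) :=
  univ.filter (· ∈ G.complex)

theorem mem_faces [Fintype V] {G : DeltaGraph V} {U : Finset V} : U ∈ G.faces ↔ U ∈ G.complex := by
  simp [faces]

/-- Tubings correspond to nests whose union is a face. -/
theorem sum_tubings [Fintype V] [DecidableEq V] {M : Type*} [AddCommMonoid M] (G : DeltaGraph V)
    (F : ℕ → M) (N : Finset (Finset G.Tube)) (hN : ∀ T, T ∈ N ↔ G.IsTubing T) :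
    ∑ T ∈ N, F T.card = ∑ U ∈ G.faces, ∑ T ∈ G.graph.nests U, F T.card := by
  classical
  rw [sum_sigma']
  have hunion : ∀ T : Finset G.Tube, (T.map (Function.Embedding.subtype _)).biUnion id =
      T.biUnion (fun t => t.1) := fun T => by
    ext v
    simp only [mem_biUnion, mem_map, Function.Embedding.coe_subtype, id]
    constructor
    · rintro ⟨_, ⟨s, hs, rfl⟩, hv⟩
      exact ⟨s, hs, hv⟩
    · rintro ⟨s, hs, hv⟩
      exact ⟨s.1, ⟨s, hs, rfl⟩, hv⟩
  refine sum_bij (fun T _ => ⟨T.biUnion (fun t => t.1), T.map (Function.Embedding.subtype _)⟩)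
    ?_ ?_ ?_ ?_
  · intro T hT
    rw [hN] at hT
    rw [mem_sigma, mem_faces, mem_nests]
    refine ⟨hT.2, ⟨fun t ht => ?_, fun s hs t ht => ?_⟩, hunion T⟩
    · obtain ⟨t, ht, rfl⟩ := mem_map.mp ht
      exact t.2.2
    · obtain ⟨t, ht', rfl⟩ := mem_map.mp ht
      obtain ⟨s, hs', rfl⟩ := mem_map.mp hs
      exact hT.1 s hs' t ht'
  · intro T _ T' _ he
    exact map_injective _ (eq_of_heq (Sigma.mk.inj_iff.mp he).2)
  · rintro ⟨U, T⟩ hT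
    rw [mem_sigma, mem_faces, mem_nests] at hT
    obtain ⟨hU, hT, hTU⟩ := hT
    simp only at hU hT hTU
    have htube : ∀ t ∈ T, G.IsTube t := fun t ht =>
      ⟨G.complex.lower (subset_biUnion_of_mem id ht) (hTU.symm ▸ hU), hT.1 t ht⟩
    have hmap : (T.subtype G.IsTube).map (Function.Embedding.subtype _) = T :=
      subtype_map_of_mem htube
    have hun : (T.subtype G.IsTube).biUnion (fun t => t.1) = U := by rw [← hunion, hmap, hTU]
    refine ⟨T.subtype G.IsTube, (hN _).mpr ⟨fun s hs t ht => ?_, ?_⟩, ?_⟩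
    · exact hT.2 s.1 (mem_subtype.mp hs) t.1 (mem_subtype.mp ht)
    · rw [hun]; exact hU
    · simp only [hun, hmap]
  · intro T _
    simp only [card_map]

/-- The exponent `n - |T|` splits at the union `U` into `(n - |U|) + (|U| - |T|)`; the bound on
faces makes both differences genuine. -/
theorem mk_faceCount [Fintype V] [DecidableEq V] {n : ℕ} {G : DeltaGraph V}
    {P : Set (EuclideanSpace ℝ (Fin n))} (h : Polyhedral.IsGraphAssociahedron G P)
    (hcard : ∀ U ∈ G.complex, U.card ≤ n) :
    (PowerSeries.mk fun k => (Polyhedral.faceCount P k : ℚ)) =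
      ∑ U ∈ G.faces, PowerSeries.X ^ (n - U.card) * weight (PowerSeries.X : ℚ⟦X⟧) G.graph U := by
  classical
  set N : Finset (Finset G.Tube) := univ.filter G.IsTubing with hNdef
  have hN : ∀ T, T ∈ N ↔ G.IsTubing T := fun T => by simp [hNdef]
  have hsum := sum_tubings G (fun c => (PowerSeries.X : ℚ⟦X⟧) ^ (n - c)) N hN
  have hle : ∀ T ∈ N, T.card ≤ n := by
    intro T hT
    have h1 := (hN T).mp hT
    refine le_trans ?_ (hcard _ h1.2)
    have hnest : G.graph.IsNest (T.map (Function.Embedding.subtype _)) := by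
      refine ⟨fun t ht => ?_, fun s hs t ht => ?_⟩
      · obtain ⟨t, ht, rfl⟩ := mem_map.mp ht
        exact t.2.2
      · obtain ⟨t, ht', rfl⟩ := mem_map.mp ht
        obtain ⟨s, hs', rfl⟩ := mem_map.mp hs
        exact h1.1 s hs' t ht'
    have h2 := hnest.card_le
    rw [card_map] at h2
    refine h2.trans (card_le_card fun v hv => ?_)
    obtain ⟨_, ht, hv⟩ := mem_biUnion.mp hv
    obtain ⟨t, ht', rfl⟩ := mem_map.mp ht
    exact mem_biUnion.mpr ⟨t, ht', hv⟩
  have hL : (PowerSeries.mk fun k => (Polyhedral.faceCount P k : ℚ)) =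
      ∑ T ∈ N, (PowerSeries.X : ℚ⟦X⟧) ^ (n - T.card) := by
    ext k
    rw [PowerSeries.coeff_mk, h.faceCount_eq, map_sum]
    simp only [PowerSeries.coeff_X_pow]
    rw [sum_boole]
    congr 1
    rw [← Set.ncard_coe_finset]
    congr 1
    ext T
    rw [mem_coe, mem_filter, hN]
    refine and_congr_right fun hT => ?_
    have := hle T ((hN T).mpr hT)
    omega
  rw [hL, hsum]
  refine sum_congr rfl fun U hU => ?_
  rw [weight, mul_sum]
  refine sum_congr rfl fun T hT => ?_
  have h1 := card_le_of_mem_nests hT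
  have h2 := hcard U (mem_faces.mp hU)
  rw [← pow_add]
  congr 1
  omega

section Sums

variable {R : Type*} [CommRing R] (x : R)

theorem image_val_univ (n : ℕ) : (univ : Finset (Fin n)).image Fin.val = range n := by
  ext a
  simp only [mem_image, mem_univ, true_and, mem_range]
  exact ⟨fun ⟨i, hi⟩ => hi ▸ i.2, fun h => ⟨⟨a, h⟩, rfl⟩⟩

theorem weight_image_val {n : ℕ} {H : SimpleGraph (Fin n)} {H' : SimpleGraph ℕ}
    (hH : ∀ i j, H'.Adj (Fin.val i) (Fin.val j) ↔ H.Adj i j) (U : Finset (Fin n)) :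
    weight x H U = weight x H' (U.image Fin.val) :=
  (weight_image x Fin.val_injective.injOn fun _ _ _ _ => hH _ _).symm

theorem natPath_adj_val {n : ℕ} (i j : Fin n) :
    natPath.Adj i.val j.val ↔ (pathGraph n).Adj i j := by
  rw [pathGraph_adj, natPath_adj]

theorem natCycle_adj_val {n : ℕ} (i j : Fin n) :
    (natCycle n).Adj i.val j.val ↔ (cycleGraph n).Adj i j := by
  have key : ∀ i j : Fin n, (i - j).val = if j.val ≤ i.val then i.val - j.val else
      n + i.val - j.val := by
    intro i j
    have hi := i.2
    have hj := j.2
    rw [Fin.val_sub]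
    split_ifs with h
    · rw [Nat.mod_eq_sub_mod (by omega), Nat.mod_eq_of_lt (by omega)]
      omega
    · rw [Nat.mod_eq_of_lt (by omega)]
      omega
  have hi := i.2
  have hj := j.2
  rw [natCycle_adj, cycleGraph_adj', key, key]
  split_ifs <;> omega

theorem sum_faces_ofSimplex {n : ℕ} {H : SimpleGraph (Fin (n + 1))} {H' : SimpleGraph ℕ}
    (hH : ∀ i j, H'.Adj (Fin.val i) (Fin.val j) ↔ H.Adj i j) :
    ∑ U ∈ (ofSimplex H).faces, x ^ (n - U.card) * weight x (ofSimplex H).graph U =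
      ∑ U ∈ (range (n + 1)).ssubsets, x ^ (n - U.card) * weight x H' U := by
  have hf : (ofSimplex H).faces = (univ : Finset (Fin (n + 1))).ssubsets := by
    ext U
    rw [mem_faces, mem_ssubsets, ssubset_univ_iff]
    rfl
  have h1 := sum_powerset_image (s := (univ : Finset (Fin (n + 1)))) Fin.val_injective.injOn
    fun U => x ^ (n - U.card) * weight x H' U
  -- Transport the sum over all subsets, then cancel the term of the full set on both sides.
  rw [sum_powerset_eq_add_sum_ssubsets (univ.image Fin.val),
    sum_powerset_eq_add_sum_ssubsets (univ : Finset (Fin (n + 1))), image_val_univ] at h1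
  rw [hf, add_left_cancel h1]
  refine sum_congr rfl fun U _ => ?_
  rw [card_image_of_injective _ Fin.val_injective, ← weight_image_val x hH]
  rfl

theorem card_le_of_mem_ofSimplex {n : ℕ} (H : SimpleGraph (Fin (n + 1))) {U : Finset (Fin (n + 1))}
    (hU : U ∈ (ofSimplex H).complex) : U.card ≤ n := by
  have := card_lt_card (ssubset_univ_iff.mpr hU)
  rw [card_univ, Fintype.card_fin] at this
  omega

theorem sum_faces_double {α : Type} [Fintype α] [DecidableEq α] {M : Type*} [AddCommGroup M]
    (H : SimpleGraph α) (F : Finset (α × Bool) → M) :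
    ∑ S ∈ (double H).faces, F S =
      pairSum univ (fun U V => F (U ×ˢ {true} ∪ V ×ˢ {false})) := by
  rw [pairSum, sum_sigma']
  symm
  refine sum_bij' (fun p _ => p.1 ×ˢ {true} ∪ p.2 ×ˢ {false})
    (fun S _ => ⟨univ.filter fun i => (i, true) ∈ S, univ.filter fun i => (i, false) ∈ S⟩)
    ?_ ?_ ?_ ?_ ?_
  · rintro ⟨U, V⟩ h
    rw [mem_sigma, mem_powerset, mem_powerset] at h
    rw [mem_faces]
    intro i hi
    simp only [mem_union, mem_product, mem_singleton] at hi
    have h1 : i ∈ U := by simpa using hi.1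
    have h2 : i ∈ V := by simpa using hi.2
    exact (mem_sdiff.mp (h.2 h2)).2 h1
  · intro S hS
    rw [mem_faces] at hS
    rw [mem_sigma, mem_powerset, mem_powerset]
    refine ⟨subset_univ _, fun i hi => mem_sdiff.mpr ⟨mem_univ _, fun hi' => ?_⟩⟩
    exact hS i ⟨(mem_filter.mp hi').2, (mem_filter.mp hi).2⟩
  · rintro ⟨U, V⟩ _
    simp
  · intro S _
    ext ⟨i, b⟩
    cases b <;> simp
  · intro p _
    rfl

/-- No edge joins the positive copy to the negative copy, so the weight is multiplicative over the
two. -/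
theorem double_pairSum_weight {α : Type} [DecidableEq α] (H : SimpleGraph α)
    (U V : Finset α) : weight x (double H).graph (U ×ˢ {true} ∪ V ×ˢ {false}) =
      weight x H U * weight x H V := by
  have himg : ∀ (U : Finset α) (b : Bool), U ×ˢ {b} = U.image fun i => (i, b) := by
    intro U b
    ext ⟨i, c⟩
    simp only [mem_product, mem_singleton, mem_image, Prod.mk.injEq]
    constructor
    · rintro ⟨h, rfl⟩
      exact ⟨i, h, rfl, rfl⟩
    · rintro ⟨j, h, rfl, rfl⟩
      exact ⟨h, rfl⟩
  have hw : ∀ (U : Finset α) (b : Bool), weight x (double H).graph (U ×ˢ {b}) = weight x H U := by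
    intro U b
    rw [himg]
    exact weight_image x (fun i _ j _ h => (Prod.mk.inj h).1) fun u _ v _ =>
      ⟨fun h => h.2, fun h => ⟨rfl, h⟩⟩
  have hne : ∀ u ∈ U ×ˢ {true}, ∀ v ∈ V ×ˢ {false}, u.2 ≠ v.2 := by
    intro u hu v hv
    rw [mem_product, mem_singleton] at hu hv
    rw [hu.2, hv.2]
    decide
  rw [weight_union, hw, hw]
  refine ⟨Finset.disjoint_left.mpr fun u hu hv => hne u hu u hv rfl, fun u hu v hv h => ?_⟩
  exact hne u hu v hv h.1

theorem card_double {α : Type} [DecidableEq α] (U V : Finset α) :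
    (U ×ˢ {true} ∪ V ×ˢ {false} : Finset (α × Bool)).card = U.card + V.card := by
  rw [card_union_of_disjoint, card_product, card_product, card_singleton, card_singleton,
    mul_one, mul_one]
  refine Finset.disjoint_left.mpr fun u hu hv => ?_
  rw [mem_product, mem_singleton] at hu hv
  exact absurd (hu.2.symm.trans hv.2) (by decide)

/-- Forgetting signs is injective on a set without opposite vertices. -/
theorem card_le_of_mem_double {α : Type} [Fintype α] (H : SimpleGraph α)
    {S : Finset (α × Bool)} (hS : S ∈ (double H).complex) : S.card ≤ Fintype.card α := by
  classical
  rw [← card_image_of_injOn (f := Prod.fst) (s := S)]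
  · exact card_le_univ _
  · rintro ⟨i, b⟩ hi ⟨j, c⟩ hj h
    simp only at h
    subst h
    cases b <;> cases c
    · rfl
    · exact absurd ⟨hj, hi⟩ (hS i)
    · exact absurd ⟨hi, hj⟩ (hS i)
    · rfl

theorem sum_faces_doubleCycle (n : ℕ) :
    ∑ S ∈ (doubleCycle n).faces, x ^ (n - S.card) * weight x (doubleCycle n).graph S =
      doubleCycleSum x n := by
  rw [doubleCycle, sum_faces_double, doubleCycleSum, ← image_val_univ,
    pairSum_image Fin.val_injective.injOn]
  refine pairSum_congr fun U _ V _ _ => ?_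
  rw [card_double, double_pairSum_weight, weight_image_val x natCycle_adj_val,
    weight_image_val x natCycle_adj_val, card_image_of_injective _ Fin.val_injective,
    card_image_of_injective _ Fin.val_injective, Nat.sub_sub]

open Classical in
theorem sum_faces_restrict {V : Type} [Fintype V] (G : DeltaGraph V) (p : V → Prop)
    [Fintype {v // p v}] (n : ℕ) :
    ∑ S ∈ (G.restrict p).faces, x ^ (n - S.card) * weight x (G.restrict p).graph S =
      ∑ S ∈ G.faces, if ∀ v ∈ S, p v then x ^ (n - S.card) * weight x G.graph S else 0 := by
  rw [← sum_filter]
  refine sum_bij (fun S _ => S.map (Function.Embedding.subtype p)) ?_ ?_ ?_ ?_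
  · intro S hS
    have hS' : S ∈ (G.restrict p).complex := mem_faces.mp hS
    rw [mem_filter, mem_faces]
    refine ⟨hS', fun v hv => ?_⟩
    obtain ⟨w, -, rfl⟩ := mem_map.mp hv
    exact w.2
  · intro S _ S' _ he
    exact map_injective _ he
  · intro S hS
    rw [mem_filter, mem_faces] at hS
    have hmap := subtype_map_of_mem hS.2
    refine ⟨S.subtype p, mem_faces.mpr ?_, hmap⟩
    change (S.subtype p).map (Function.Embedding.subtype p) ∈ G.complex
    rw [hmap]
    exact hS.1
  · intro S _
    rw [card_map, map_eq_image, Function.Embedding.coe_subtype]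
    rw [weight_image (H := (G.restrict p).graph) x Subtype.val_injective.injOn]
    exact fun _ _ _ _ => Iff.rfl

theorem sum_faces_cisDoublePath (n : ℕ) :
    ∑ S ∈ (cisDoublePath n).faces, x ^ (n - S.card) * weight x (cisDoublePath n).graph S =
      doublePathSumLeft x true n := by
  classical
  -- The swap makes the negative copy, which lacks its two ends, the first set of the pair.
  rw [cisDoublePath, sum_faces_restrict, doublePath, sum_faces_double, doublePathSumLeft, pairSum_swap,
    ← image_val_univ, pairSum_image Fin.val_injective.injOn]
  refine pairSum_congr fun U _ V _ _ => ?_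
  have hiff : (∀ v ∈ V ×ˢ {true} ∪ U ×ˢ {false},
      ¬ (v.2 = false ∧ (v.1.val = 0 ∨ v.1.val + 1 = n))) ↔
      n - 1 ∉ U.image Fin.val ∧ 0 ∉ U.image Fin.val := by
    constructor
    · intro h
      constructor <;> intro h' <;> obtain ⟨i, hi, he⟩ := mem_image.mp h' <;>
        refine h (i, false) (by simp [hi]) ⟨rfl, ?_⟩
      · have := i.2
        exact Or.inr (by simp only; omega)
      · exact Or.inl he
    · rintro ⟨h1, h2⟩ ⟨i, b⟩ hv ⟨hb, h⟩
      simp only at hb h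
      subst hb
      have hi : i ∈ U := by simpa using hv
      rcases h with h | h
      · exact h2 (mem_image.mpr ⟨i, hi, h⟩)
      · exact h1 (mem_image.mpr ⟨i, hi, by omega⟩)
  rw [pairWeight, card_image_of_injective _ Fin.val_injective,
    card_image_of_injective _ Fin.val_injective, ← weight_image_val x natPath_adj_val,
    ← weight_image_val x natPath_adj_val, card_double, double_pairSum_weight]
  by_cases h1 : n - 1 ∈ U.image Fin.val
  · rw [if_pos h1, if_neg fun h => (hiff.mp h).1 h1]
  by_cases h2 : 0 ∈ U.image Fin.val
  · rw [if_neg h1, if_neg fun h => (hiff.mp h).2 h2, if_neg fun h => h rfl h2]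
  · rw [if_neg h1, if_pos (hiff.mpr ⟨h1, h2⟩), if_pos fun _ => h2, add_comm V.card, Nat.sub_sub,
      mul_comm (weight x (pathGraph n) V)]

end Sums

/-! ### The four f-polynomials in terms of weights. -/

section FSeries

open Polyhedral

variable {P : (n : ℕ) → Set (EuclideanSpace ℝ (Fin n))}

theorem fSeries_path (h : ∀ n, IsGraphAssociahedron (path n) (P n)) :
    fSeries P = PowerSeries.mk fun n => pathWeight (PowerSeries.X : ℚ⟦X⟧) (n + 1) := by
  rw [fSeries]
  congr 1
  funext n
  rw [mk_faceCount (h n), path, sum_faces_ofSimplex _ natPath_adj_val, pathWeight_succ]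
  exact fun U hU => card_le_of_mem_ofSimplex _ hU

theorem fSeries_cycle (h : ∀ n, IsGraphAssociahedron (cycle n) (P n)) :
    fSeries P = PowerSeries.mk fun n => cycleWeight (PowerSeries.X : ℚ⟦X⟧) (n + 1) := by
  rw [fSeries]
  congr 1
  funext n
  rw [mk_faceCount (h n), cycle, sum_faces_ofSimplex _ natCycle_adj_val, cycleWeight_succ]
  exact fun U hU => card_le_of_mem_ofSimplex _ hU

theorem fSeries_cisDoublePath (h : ∀ n, IsGraphAssociahedron (cisDoublePath n) (P n)) :
    fSeries P = PowerSeries.mk fun n => doublePathSumLeft (PowerSeries.X : ℚ⟦X⟧) true n := by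
  rw [fSeries]
  congr 1
  funext n
  rw [mk_faceCount (h n), sum_faces_cisDoublePath]
  intro U hU
  have := card_le_of_mem_double (pathGraph n) hU
  rwa [Fintype.card_fin, card_map] at this

theorem fSeries_doubleCycle (h : ∀ n, IsGraphAssociahedron (doubleCycle n) (P n)) :
    fSeries P = PowerSeries.mk fun n => doubleCycleSum (PowerSeries.X : ℚ⟦X⟧) n := by
  rw [fSeries]
  congr 1
  funext n
  rw [mk_faceCount (h n), sum_faces_doubleCycle]
  intro U hU
  have := card_le_of_mem_double _ hU
  rwa [Fintype.card_fin] at this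

end FSeries

end DeltaGraph

/-! ### Generating functions -/

namespace SimpleGraph

open Finset PowerSeries

section Series

variable {R : Type*} [CommRing R] (x : R)

/-- The generating series of the associahedra. -/
noncomputable def pathSeries : R⟦X⟧ := PowerSeries.mk fun n => pathWeight x (n + 1)

/-- The generating series of the cyclohedra. -/
noncomputable def cycleSeries : R⟦X⟧ := PowerSeries.mk fun n => cycleWeight x (n + 1)

theorem mk_pathWeight : PowerSeries.mk (pathWeight x) = 1 + X * pathSeries x := by
  ext n
  cases n with
  | zero => simp [pathWeight_zero]
  | succ n => simp [pathSeries, coeff_succ_X_mul, coeff_one]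

theorem mk_pathSum : PowerSeries.mk (pathSum x) = 1 + (1 + C x) * (X * pathSeries x) := by
  ext n
  rw [mul_left_comm]
  cases n with
  | zero => simp [pathSum_zero]
  | succ n =>
    rw [coeff_mk, pathSum_succ, map_add, coeff_succ_X_mul, add_mul, add_mul, map_add,
      one_mul, one_mul, coeff_C_mul]
    simp [pathSeries, coeff_one]

theorem mk_pathSum_eq : PowerSeries.mk (pathSum x) = PowerSeries.mk (pathWeight x) +
    X * (C x * (PowerSeries.mk (pathSum x) * PowerSeries.mk (pathWeight x))) := by
  ext n
  cases n with
  | zero => simp [pathWeight_zero, pathSum_zero]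
  | succ n =>
    rw [coeff_mk, pathSum_eq, map_add, coeff_mk, coeff_succ_X_mul, coeff_C_mul, coeff_mul,
      Finset.Nat.sum_antidiagonal_eq_sum_range_succ_mk, mul_sum]
    simp

/-- The summand depends only on the arc length `k + (N - l)` and the gap `l - k`. A given length `s`
occurs `s + 1` times, and this multiplicity becomes a derivative in the generating series. -/
theorem sum_range_sum_range {M : Type*} [AddCommMonoid M] (N : ℕ) (f : ℕ → ℕ → M) :
    ∑ l ∈ range (N + 1), ∑ k ∈ range (l + 1), f (k + (N - l)) (l - k) =
      ∑ p ∈ antidiagonal N, (p.1 + 1) • f p.1 p.2 := by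
  have h : ∀ p ∈ antidiagonal N, (p.1 + 1) • f p.1 p.2 = ∑ _k ∈ range (p.1 + 1), f p.1 p.2 :=
    fun p _ => by simp
  rw [sum_congr rfl h, sum_sigma', sum_sigma']
  refine sum_bij' (fun a _ => ⟨(a.2 + (N - a.1), a.1 - a.2), a.2⟩)
    (fun b _ => ⟨b.1.2 + b.2, b.2⟩) ?_ ?_ ?_ ?_ ?_
  · rintro ⟨l, k⟩ h
    simp only [mem_sigma, mem_range, HasAntidiagonal.mem_antidiagonal] at h ⊢
    omega
  · rintro ⟨⟨s, m⟩, k⟩ h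
    simp only [mem_sigma, mem_range, HasAntidiagonal.mem_antidiagonal] at h ⊢
    omega
  · rintro ⟨l, k⟩ h
    simp only [mem_sigma, mem_range] at h
    simp only [Sigma.mk.injEq, heq_eq_eq, and_true]
    omega
  · rintro ⟨⟨s, m⟩, k⟩ h
    simp only [mem_sigma, mem_range, HasAntidiagonal.mem_antidiagonal] at h
    simp only [Sigma.mk.injEq, heq_eq_eq, and_true, Prod.mk.injEq]
    omega
  · rintro ⟨l, k⟩ _
    rfl

theorem cycleSeries_eq : cycleSeries x = derivative R (X * PowerSeries.mk (pathWeight x)) *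
    (1 + X * (C x * PowerSeries.mk (pathSum x))) := by
  have hd : ∀ n, coeff n (derivative R (X * PowerSeries.mk (pathWeight x))) =
      (n + 1) * pathWeight x n := fun n => by
    rw [coeff_derivative, coeff_succ_X_mul, coeff_mk, mul_comm]
  ext n
  rw [cycleSeries, coeff_mk, cycleWeight_eq, mul_add, mul_one, map_add, hd]
  congr 1
  rw [mul_left_comm]
  cases n with
  | zero => simp
  | succ N =>
    rw [sum_range_succ', range_zero, sum_empty, add_zero, coeff_succ_X_mul, mul_left_comm,
      coeff_C_mul, coeff_mul, mul_sum]
    have := sum_range_sum_range N fun s m => x * (pathWeight x s * pathSum x m)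
    convert this using 1
    · refine sum_congr rfl fun l _ => sum_congr rfl fun k _ => ?_
      rw [show N + 1 - (l + 1) = N - l by omega, show l + 1 - 1 - k = l - k by omega]
    · refine sum_congr rfl fun p _ => ?_
      rw [hd, coeff_mk, nsmul_eq_mul]
      push_cast
      ring

theorem mk_conv (a : ℕ → R) (n : ℕ) : ∑ k ∈ range (n + 1), a k * pathWeight x (n + 1 - k) =
    coeff n (PowerSeries.mk a * pathSeries x) := by
  rw [coeff_mul, Finset.Nat.sum_antidiagonal_eq_sum_range_succ_mk]
  refine sum_congr rfl fun k hk => ?_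
  rw [mem_range] at hk
  rw [coeff_mk, pathSeries, coeff_mk, show n - k + 1 = n + 1 - k by omega]

/-- Dropping the term `k = 0` amounts to subtracting the constant coefficient `a 0 = 1` from the
series. -/
theorem mk_conv_ite (b : Bool) (a : ℕ → R) (h0 : a 0 = 1) (n : ℕ) :
    ∑ k ∈ range (n + 1), (if b = true ∧ k = 0 then 0 else a k * pathWeight x (n + 1 - k)) =
    coeff n ((PowerSeries.mk a - if b = true then 1 else 0) * pathSeries x) := by
  cases b with
  | false => simp [mk_conv]
  | true =>
    rw [sub_mul, map_sub, ← mk_conv, sum_range_succ', sum_range_succ']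
    simp [h0, pathSeries]

theorem mk_doublePathSum (b : Bool) : PowerSeries.mk (doublePathSum x b) =
    1 + X * (C x * PowerSeries.mk (doublePathSum x b) +
      (PowerSeries.mk (doublePathSumLeft x b) - if b = true then 1 else 0) * pathSeries x +
      PowerSeries.mk (doublePathSumRight x b) * pathSeries x) := by
  ext n
  cases n with
  | zero => simp [doublePathSum_zero]
  | succ n =>
    rw [coeff_mk, doublePathSum_succ, mk_conv, mk_conv_ite x b _ (doublePathSumLeft_zero x b),
      map_add, coeff_succ_X_mul, map_add, map_add, coeff_C_mul, coeff_mk]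
    simp [coeff_one]

theorem mk_doublePathSumLeft (b : Bool) : PowerSeries.mk (doublePathSumLeft x b) =
    1 + X * (C x * PowerSeries.mk (doublePathSum x b) +
      PowerSeries.mk (doublePathSumRight x b) * pathSeries x) := by
  ext n
  cases n with
  | zero => simp [doublePathSumLeft_zero]
  | succ n =>
    rw [coeff_mk, doublePathSumLeft_succ, mk_conv, map_add, coeff_succ_X_mul, map_add, coeff_C_mul,
      coeff_mk]
    simp [coeff_one]

theorem mk_doublePathSumRight (b : Bool) : PowerSeries.mk (doublePathSumRight x b) =
    1 + X * (C x * PowerSeries.mk (doublePathSum x b) +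
      (PowerSeries.mk (doublePathSumLeft x b) - if b = true then 1 else 0) * pathSeries x) := by
  ext n
  cases n with
  | zero => simp [doublePathSumRight_zero]
  | succ n =>
    rw [coeff_mk, doublePathSumRight_succ, mk_conv_ite x b _ (doublePathSumLeft_zero x b),
      map_add, coeff_succ_X_mul, map_add, coeff_C_mul, coeff_mk]
    simp [coeff_one]

/-- The generating series of the cis double path associahedra. -/
noncomputable def cisSeries : R⟦X⟧ := PowerSeries.mk (doublePathSumLeft x true)

theorem cisSeries_eq : (cisSeries x - 1) *
    ((1 - X * C x - X * pathSeries x * (1 + X * C x)) * (1 + X * pathSeries x)) =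
      X * C x * (1 + X * pathSeries x) + X * pathSeries x := by
  have h1 := mk_doublePathSum x true
  have h2 := mk_doublePathSumLeft x true
  have h3 := mk_doublePathSumRight x true
  rw [← cisSeries] at h1 h2 h3
  simp only [if_true] at h1 h2 h3
  generalize cisSeries x = L at *
  generalize PowerSeries.mk (doublePathSum x true) = S at *
  generalize PowerSeries.mk (doublePathSumRight x true) = E at *
  generalize pathSeries x = A at *
  generalize (C x : R⟦X⟧) = c at *
  -- With `W = X * A`, `h1 - h2` reads `S - L = W (L - 1)` and `h3 - h2` reads `(1 + W) E = L + W (L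
  -- - 1)`; these eliminate `S` and `E` from `(1 + W)` times `h2`.
  linear_combination (1 + X * A) * h2 + X * c * (1 + X * A) * (h1 - h2) + X * A * (h3 - h2)

theorem mk_doublePathSum_false : PowerSeries.mk (doublePathSum x false) *
    (1 - X * C x - X * pathSeries x * (1 + X * C x)) = 1 + X * pathSeries x := by
  have h1 := mk_doublePathSum x false
  have h2 := mk_doublePathSumLeft x false
  have h3 := mk_doublePathSumRight x false
  simp only [Bool.false_eq_true, if_false, sub_zero] at h1 h2 h3
  generalize PowerSeries.mk (doublePathSumLeft x false) = L at *
  generalize PowerSeries.mk (doublePathSum x false) = S at *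
  generalize PowerSeries.mk (doublePathSumRight x false) = E at *
  generalize pathSeries x = A at *
  generalize (C x : R⟦X⟧) = c at *
  linear_combination (1 - X * A) * h1 + X * A * h2 + X * A * h3

theorem mk_doubleCycleSum : PowerSeries.mk (doubleCycleSum x) =
    1 + X * (C x * PowerSeries.mk (doublePathSum x false) + 2 * cycleSeries x +
      2 * (derivative R (X * pathSeries x) * (cisSeries x - 1))) := by
  ext n
  cases n with
  | zero => simp [doubleCycleSum, pairSum_empty, weight_empty]
  | succ n =>
    rw [coeff_mk, doubleCycleSum_succ, map_add, coeff_succ_X_mul, map_add, map_add, coeff_C_mul,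
      coeff_mk, ← map_ofNat (C (R := R)) 2, coeff_C_mul, coeff_C_mul, cycleSeries, coeff_mk]
    -- The complementary path has at least one vertex, so the constant term of the cis series is
    -- removed.
    have hcis : cisSeries x - 1 = X * PowerSeries.mk fun m => doublePathSumLeft x true (m + 1) := by
      ext m
      cases m with
      | zero => simp [cisSeries, doublePathSumLeft_zero]
      | succ m => simp [cisSeries, coeff_succ_X_mul, coeff_one]
    have hd : ∀ m, coeff m (derivative R (X * pathSeries x)) = (m + 1) * pathWeight x (m + 1) :=
      fun m => by rw [coeff_derivative, coeff_succ_X_mul, pathSeries, coeff_mk, mul_comm]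
    have key : ∑ l ∈ range (n + 1), ∑ k ∈ range l,
        pathWeight x (k + 1 + (n - l)) * doublePathSumLeft x true (l - k) =
        coeff n (derivative R (X * pathSeries x) * (cisSeries x - 1)) := by
      rw [hcis, mul_left_comm]
      cases n with
      | zero => simp
      | succ N =>
        rw [sum_range_succ', range_zero, sum_empty, add_zero, coeff_succ_X_mul, coeff_mul]
        have := sum_range_sum_range N fun s m =>
          pathWeight x (s + 1) * doublePathSumLeft x true (m + 1)
        convert this using 1
        · refine sum_congr rfl fun l _ => sum_congr rfl fun k hk => ?_
          rw [mem_range] at hk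
          rw [show k + 1 + (N + 1 - (l + 1)) = k + (N - l) + 1 by omega,
            show l + 1 - k = l - k + 1 by omega]
        · refine sum_congr rfl fun p _ => ?_
          rw [hd, coeff_mk, nsmul_eq_mul]
          push_cast
          ring
    rw [key]
    simp [coeff_one]

/-- The two expressions for the path sums differ from the quadratic by a factor `x`, which has to be
cancelled; hence `x ≠ 0` in a domain. -/
theorem pathSeries_quadratic [IsDomain R] (hx : x ≠ 0) : X * pathSeries x =
    X * ((1 + X * pathSeries x) * (1 + (1 + C x) * (X * pathSeries x))) := by
  have h1 := mk_pathSum_eq x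
  rw [mk_pathSum, mk_pathWeight] at h1
  have hC : (C x : R⟦X⟧) ≠ 0 := fun h => hx (by simpa using congrArg constantCoeff h)
  refine mul_left_cancel₀ hC ?_
  linear_combination h1

theorem cycleSeries_mul : cycleSeries x * (1 - X * C x * (1 + X * pathSeries x)) =
    1 + X * pathSeries x + X * derivative R (X * pathSeries x) := by
  have h1 := mk_pathSum_eq x
  rw [cycleSeries_eq]
  rw [mk_pathWeight] at *
  have hd : derivative R (X * (1 + X * pathSeries x)) =
      1 + X * pathSeries x + X * derivative R (X * pathSeries x) := by
    rw [Derivation.leibniz, map_add, Derivation.map_one_eq_zero, derivative_X]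
    simp only [smul_eq_mul]
    ring
  rw [hd]
  linear_combination (1 + X * pathSeries x + X * derivative R (X * pathSeries x)) * X * C x * h1

theorem derivative_pathSeries [IsDomain R] (hx : x ≠ 0) :
    derivative R (X * pathSeries x) *
      (1 - X * (1 + (1 + C x) * (X * pathSeries x)) -
        X * (1 + X * pathSeries x) * (1 + C x)) =
      (1 + X * pathSeries x) * (1 + (1 + C x) * (X * pathSeries x)) := by
  have h := congrArg (derivative R) (pathSeries_quadratic x hx)
  have hC : derivative R (C x : R⟦X⟧) = 0 := derivative_C
  generalize X * pathSeries x = W at *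
  simp only [Derivation.leibniz, map_add, Derivation.map_one_eq_zero, derivative_X, smul_eq_mul,
    hC] at h
  linear_combination h

/-- The double path and the cycle have the same face numbers. -/
theorem mk_doublePathSum_false_eq_cycleSeries [IsDomain R] (hx : x ≠ 0) :
    PowerSeries.mk (doublePathSum x false) = cycleSeries x := by
  have h1 := mk_doublePathSum_false x
  have h2 := cycleSeries_mul x
  have h3 := pathSeries_quadratic x hx
  have h4 := derivative_pathSeries x hx
  -- Both series solve linear equations whose coefficients have constant term 1, so multiplying by
  -- the two coefficients loses nothing.
  have hu : 1 - X * C x - X * pathSeries x * (1 + X * C x) ≠ 0 := fun h => by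
    simpa using congrArg constantCoeff h
  have hv : 1 - X * C x * (1 + X * pathSeries x) ≠ 0 := fun h => by
    simpa using congrArg constantCoeff h
  refine mul_right_cancel₀ (mul_ne_zero hu hv) ?_
  generalize PowerSeries.mk (doublePathSum x false) = D at *
  generalize cycleSeries x = B at *
  generalize derivative R (X * pathSeries x) = W' at *
  generalize X * pathSeries x = W at *
  generalize (C x : R⟦X⟧) = c at *
  -- Writing `u` and `v` for the coefficients in `h1` and `h2`, one has `v - u = W`, so the claim
  -- reduces to `X * W' * u = W * (1 + W)`; this follows from the quadratic and its derivative.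
  have h5 : X * W' * (1 - X * c - W * (1 + X * c)) = W * (1 + W) := by
    linear_combination (X * (1 + W)) * h4 - ((1 + W) + 2 * X * W') * h3
  linear_combination (1 - X * c * (1 + W)) * h1 - (1 - X * c - W * (1 + X * c)) * h2 - h5

theorem mk_doubleCycleSum_eq [IsDomain R] (hx : x ≠ 0) : PowerSeries.mk (doubleCycleSum x) =
    1 + (C x * X + 2 * X) * cycleSeries x +
      2 * X * (pathSeries x + X * derivative R (pathSeries x)) * (cisSeries x - 1) := by
  rw [mk_doubleCycleSum, mk_doublePathSum_false_eq_cycleSeries x hx, Derivation.leibniz,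
    derivative_X]
  simp only [smul_eq_mul]
  ring

end Series

end SimpleGraph

/-! ### Specialization at `x = 0` and the square root. -/

open SimpleGraph PowerSeries in
theorem exists_sqrt_doubleCycleSum :
    ∃ S : ℚ⟦X⟧, PowerSeries.constantCoeff S = 1 ∧ S ^ 2 = 1 - 4 * PowerSeries.X ∧
      Polyhedral.atXZero (PowerSeries.mk (doubleCycleSum (PowerSeries.X : ℚ⟦X⟧))) =
        1 + (1 - S - 2 * PowerSeries.X) * (1 - 4 * PowerSeries.X)⁻¹
          + 2 * PowerSeries.X * S⁻¹ := by
  have hx : (X : ℚ⟦X⟧) ≠ 0 := X_ne_zero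
  -- The identities are proved for the indeterminate `x` and only then specialized, since the
  -- quadratic was obtained by cancelling `x`.
  set φ : ℚ⟦X⟧⟦X⟧ →+* ℚ⟦X⟧ := PowerSeries.map PowerSeries.constantCoeff with hφ
  have hφC : φ (C X) = 0 := by simp [hφ]
  have hφX : φ X = X := by simp [hφ]
  have h1 := congrArg φ (mk_doubleCycleSum (X : ℚ⟦X⟧))
  have h2 := congrArg φ (cycleSeries_mul (X : ℚ⟦X⟧))
  have h3 := congrArg φ (pathSeries_quadratic (X : ℚ⟦X⟧) hx)
  have h4 := congrArg φ (derivative_pathSeries (X : ℚ⟦X⟧) hx)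
  have h5 := congrArg φ (cisSeries_eq (X : ℚ⟦X⟧))
  simp only [map_mul, map_add, map_sub, map_one, map_ofNat, hφC, hφX, mul_zero, zero_mul, add_zero,
    sub_zero, zero_add, mul_one, one_mul] at h1 h2 h3 h4 h5
  change ∃ S : ℚ⟦X⟧, _ ∧ _ ∧ φ (PowerSeries.mk (doubleCycleSum X)) = _
  generalize φ (PowerSeries.mk (doubleCycleSum X)) = F at *
  generalize φ (cycleSeries X) = B at *
  generalize φ (derivative ℚ⟦X⟧ (X * pathSeries X)) = W' at *
  generalize φ (cisSeries X) = L at *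
  generalize φ (pathSeries X) = A at *
  have hS : constantCoeff (1 - 2 * X * (1 + X * A) : ℚ⟦X⟧) = 1 := by simp
  have hT : constantCoeff (1 - 4 * X : ℚ⟦X⟧) = 1 := by simp
  have hS2 : (1 - 2 * X * (1 + X * A) : ℚ⟦X⟧) ^ 2 = 1 - 4 * X := by
    linear_combination (-4 * X) * h3
  -- The discriminant root of `W = y (1 + W)^2`, on the branch with constant term 1.
  refine ⟨1 - 2 * X * (1 + X * A), hS, hS2, ?_⟩
  have hi := PowerSeries.mul_inv_cancel (1 - 2 * X * (1 + X * A) : ℚ⟦X⟧) (by rw [hS]; exact one_ne_zero)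
  have hj := PowerSeries.mul_inv_cancel (1 - 4 * X : ℚ⟦X⟧) (by rw [hT]; exact one_ne_zero)
  generalize hSdef : (1 - 2 * X * (1 + X * A) : ℚ⟦X⟧) = S at *
  generalize hW : X * A = W at *
  have hne : (1 - 4 * X : ℚ⟦X⟧) ≠ 0 := fun h => by rw [h] at hT; simp at hT
  have e1 : S * (1 + W) = 1 - W := by rw [← hSdef]; linear_combination 2 * h3
  have e2 : W' * S = (1 + W) ^ 2 := by rw [← hSdef]; linear_combination h4
  have e3 : B * S = 1 := by rw [h2]; linear_combination e1 + X * e2 - h3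
  -- By `e2` and `e1`, `W' * S ^ 2 = (1 + W) * (1 - W)`, which is exactly the coefficient of `L - 1`
  -- in the cis equation `h5`.
  have e4 : X * W' * (L - 1) * S ^ 2 = X * W := by
    linear_combination X * (L - 1) * S * e2 + X * (L - 1) * (1 + W) * e1 + X * h5
  refine mul_left_cancel₀ hne ?_
  have e5 : (1 - 4 * X) * F = S ^ 2 + 2 * X * S + 2 * X * W := by
    rw [← hS2, h1]
    linear_combination 2 * X * S * e3 + 2 * e4
  rw [e5]
  have e6 : (1 - 4 * X) * S⁻¹ = S := by rw [← hS2]; linear_combination S * hi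
  linear_combination hS2 - (1 - S - 2 * X) * hj - 2 * X * e6 - hSdef

theorem mainTheorem4
    (A B C DC : (n : ℕ) → Set (EuclideanSpace ℝ (Fin n)))
    (hA : ∀ n, Polyhedral.IsGraphAssociahedron (DeltaGraph.path n) (A n))
    (hB : ∀ n, Polyhedral.IsGraphAssociahedron (DeltaGraph.cycle n) (B n))
    (hC : ∀ n, Polyhedral.IsGraphAssociahedron (DeltaGraph.cisDoublePath n) (C n))
    (hDC : ∀ n, Polyhedral.IsGraphAssociahedron (DeltaGraph.doubleCycle n) (DC n)) :
    (Polyhedral.fSeries DC =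
      1 + (Polyhedral.varX * Polyhedral.varY + 2 * Polyhedral.varY) * Polyhedral.fSeries B
        + 2 * Polyhedral.varY
          * (Polyhedral.fSeries A + Polyhedral.varY * Polyhedral.Dy (Polyhedral.fSeries A))
          * (Polyhedral.fSeries C - 1)) ∧
    ∃ S : ℚ⟦X⟧, PowerSeries.constantCoeff S = 1 ∧ S ^ 2 = 1 - 4 * PowerSeries.X ∧
      Polyhedral.atXZero (Polyhedral.fSeries DC) =
        1 + (1 - S - 2 * PowerSeries.X) * (1 - 4 * PowerSeries.X)⁻¹
          + 2 * PowerSeries.X * S⁻¹ := by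
  rw [DeltaGraph.fSeries_path hA, DeltaGraph.fSeries_cycle hB, DeltaGraph.fSeries_cisDoublePath hC,
    DeltaGraph.fSeries_doubleCycle hDC]
  exact ⟨SimpleGraph.mk_doubleCycleSum_eq PowerSeries.X PowerSeries.X_ne_zero,
    exists_sqrt_doubleCycleSum⟩
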